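/- Let $k$ be a field of characteristic zero and let $H=\bigoplus_{n\ge 0}H_n$ be a connected graded Hopf algebra over $k$, i.e. a Hopf algebra with a grading making it both a graded algebra and a graded coalgebra, whose antipode preserves the grading, and with $H_0=k\cdot 1$. Assume that $H$ has finite Gelfand–Kirillov dimension $d$, where $$\operatorname{GKdim} H=\sup_V\limsup_{n\to\infty}\frac{\log\dim_k (k+V+V^2+\cdots+V^n)}{\log n},$$ the supremum being over all finite-dimensional subspaces $V\subseteq H$. Let $P(H)=\{x\in H : \Delta(x)=x\otimes 1+1\otimes x\}$ be the primitive space of $H$, a Lie algebra under the commutator. Its universal enveloping algebra $U(P(H))$ carries its standard Hopf algebra structure, in which the elements of $P(H)$ are primitive, and the grading whose degree $n$ part is spanned by the products $x_1\cdots x_r$ with $x_i\in P(H)\cap H_{n_i}$ and $n_1+\cdots+n_r=n$. Then $e:=\dim_k P(H)$ is finite, $d-e$ is a non-negative integer, and $H$ is a graded $(d-e)$-step iterated Hopf Ore extension of derivation type of $U(P(H))$. That is: $U(P(H))$ is a graded Hopf algebra, the canonical map $U(P(H))\to H$ extending the inclusion $P(H)\subseteq H$ is an injective homomorphism of graded Hopf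 algebras, and, writing $\overline U$ for its image, there is a chain of graded Hopf subalgebras $$\overline U=H^0\subseteq H^1\subseteq\cdots\subseteq H^{d-e}=H$$ such that for every $1\le i\le d-e$ one has $H^i=H^{i-1}[z_i;\delta_i]$ for some homogeneous element $z_i\in H^i$ and some derivation $\delta_i$ of $H^{i-1}$ which is homogeneous of degree $\deg z_i$; this means that $H^i$ is a free left $H^{i-1}$-module with basis $1,z_i,z_i^2,\dots$ and $z_i b=b z_i+\delta_i(b)$ for all $b\in H^{i-1}$. -/

import Mathlib

open scoped TensorProduct

-- The commutator bracket `⁅x, y⁆ = x * y - y * x` on an associative ring.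
attribute [local instance 100] LieRing.ofAssociativeRing

/-! ### Gelfand–Kirillov dimension -/

/-- The Gelfand–Kirillov dimension of a `k`-algebra `A`: the supremum over all finite-dimensional
subspaces `V` of `limsup_n log (dim (k + V + V² + ⋯ + Vⁿ)) / log n`. -/
noncomputable def gkDim (k A : Type*) [Field k] [Ring A] [Algebra k A] : EReal :=
  ⨆ V : {V : Submodule k A // Module.Finite k V},
    Filter.limsup (fun n : ℕ =>
      ((Real.log (Module.finrank k (⨆ i ∈ Finset.range (n + 1), V.1 ^ i : Submodule k A))
        / Real.log n : ℝ) : EReal)) Filter.atTop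

/-! ### Universal enveloping algebras are Hopf algebras -/

namespace EnvHopf

section

variable (k L : Type*) [Field k] [LieRing L] [LieAlgebra k L]

local notation "U" => UniversalEnvelopingAlgebra k L
local notation "ι" => UniversalEnvelopingAlgebra.ι k

/-- The Lie algebra map `x ↦ x ⊗ 1 + 1 ⊗ x`. -/
noncomputable def comulLie : L →ₗ⁅k⁆ (U ⊗[k] U) where
  toFun x := ι x ⊗ₜ[k] 1 + 1 ⊗ₜ[k] ι x
  map_add' x y := by
    simp only [map_add, TensorProduct.add_tmul, TensorProduct.tmul_add]; abel
  map_smul' c x := by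
    simp only [map_smul, smul_add, TensorProduct.smul_tmul', TensorProduct.tmul_smul,
      RingHom.id_apply]
  map_lie' {x y} := by
    simp only [LieHom.map_lie, LieRing.of_associative_ring_bracket, add_mul, mul_add,
      Algebra.TensorProduct.tmul_mul_tmul, mul_one, one_mul, TensorProduct.sub_tmul,
      TensorProduct.tmul_sub]
    abel

/-- The comultiplication of `U(L)`, determined by `x ↦ x ⊗ 1 + 1 ⊗ x` on `L`. -/
noncomputable def comulHom : U →ₐ[k] U ⊗[k] U :=
  UniversalEnvelopingAlgebra.lift k (comulLie k L)

/-- The counit of `U(L)`, determined by `x ↦ 0` on `L`. -/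
noncomputable def counitHom : U →ₐ[k] k :=
  UniversalEnvelopingAlgebra.lift k (0 : L →ₗ⁅k⁆ k)

/-- The Lie algebra map `x ↦ -x` to the opposite algebra. -/
noncomputable def antipodeLie : L →ₗ⁅k⁆ Uᵐᵒᵖ where
  toFun x := MulOpposite.op (-ι x)
  map_add' x y := by simp only [map_add, neg_add, MulOpposite.op_add]
  map_smul' c x := by simp only [map_smul, smul_neg, MulOpposite.op_neg, MulOpposite.op_smul,
    RingHom.id_apply]
  map_lie' {x y} := by
    apply MulOpposite.unop_injective
    simp only [LieHom.map_lie, LieRing.of_associative_ring_bracket, MulOpposite.unop_op,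
      MulOpposite.unop_sub, MulOpposite.unop_mul]
    simp

/-- The antipode of `U(L)` as an algebra map to the opposite algebra, `x ↦ -x` on `L`. -/
noncomputable def antipodeHom : U →ₐ[k] Uᵐᵒᵖ :=
  UniversalEnvelopingAlgebra.lift k (antipodeLie k L)

/-- The antipode of `U(L)`, the anti-automorphism with `x ↦ -x` on `L`. -/
noncomputable def antipodeLin : U →ₗ[k] U :=
  (MulOpposite.opLinearEquiv k).symm.toLinearMap ∘ₗ (antipodeHom k L).toLinearMap

variable {k L}

theorem comulHom_ι (x : L) : comulHom k L (ι x) = ι x ⊗ₜ[k] 1 + 1 ⊗ₜ[k] ι x :=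
  UniversalEnvelopingAlgebra.lift_ι_apply k _ x

theorem counitHom_ι (x : L) : counitHom k L (ι x) = 0 :=
  UniversalEnvelopingAlgebra.lift_ι_apply k _ x

theorem antipodeLin_ι (x : L) : antipodeLin k L (ι x) = -ι x :=
  congrArg MulOpposite.unop (UniversalEnvelopingAlgebra.lift_ι_apply k (antipodeLie k L) x)

theorem antipodeLin_one : antipodeLin k L 1 = 1 :=
  congrArg MulOpposite.unop (map_one (antipodeHom k L))

theorem antipodeLin_mul (a b : U) :
    antipodeLin k L (a * b) = antipodeLin k L b * antipodeLin k L a :=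
  congrArg MulOpposite.unop (map_mul (antipodeHom k L) a b)

theorem adjoin_ι : Algebra.adjoin k (Set.range (ι : L → U)) = ⊤ := by
  set S := Algebra.adjoin k (Set.range (ι : L → U)) with hS
  let f : L →ₗ⁅k⁆ S :=
    { toFun := fun x => ⟨ι x, Algebra.subset_adjoin ⟨x, rfl⟩⟩
      map_add' := fun x y => Subtype.ext (map_add _ _ _)
      map_smul' := fun c x => Subtype.ext (map_smul _ _ _)
      map_lie' := fun {x y} => Subtype.ext (LieHom.map_lie _ _ _) }
  have h : S.val.comp (UniversalEnvelopingAlgebra.lift k f) = AlgHom.id k U := by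
    apply UniversalEnvelopingAlgebra.hom_ext
    ext x
    change ((UniversalEnvelopingAlgebra.lift k f (ι x) : S) : U) = ι x
    rw [UniversalEnvelopingAlgebra.lift_ι_apply]
    rfl
  rw [eq_top_iff]
  intro u _
  have := congrArg (fun g : U →ₐ[k] U => g u) h
  change ((UniversalEnvelopingAlgebra.lift k f u : S) : U) = u at this
  rw [← this]
  exact Subtype.property _

theorem hom_ext' {B : Type*} [Ring B] [Algebra k B] {f g : U →ₐ[k] B}
    (h : ∀ x : L, f (ι x) = g (ι x)) : f = g :=
  UniversalEnvelopingAlgebra.hom_ext k (LieHom.ext h)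

noncomputable instance : Bialgebra k U :=
  Bialgebra.ofAlgHom (comulHom k L) (counitHom k L)
    (by
      apply hom_ext'
      intro x
      simp [-UniversalEnvelopingAlgebra.ι_apply, comulHom_ι, TensorProduct.add_tmul, TensorProduct.tmul_add,
        Algebra.TensorProduct.one_def, add_assoc])
    (by
      apply hom_ext'
      intro x
      simp [-UniversalEnvelopingAlgebra.ι_apply, comulHom_ι, counitHom_ι])
    (by
      apply hom_ext'
      intro x
      simp [-UniversalEnvelopingAlgebra.ι_apply, comulHom_ι, counitHom_ι])

theorem antipode_left (u : U) (t : U ⊗[k] U) :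
    LinearMap.mul' k U ((antipodeLin k L).rTensor U (comulHom k L u * t)) =
      counitHom k L u • LinearMap.mul' k U ((antipodeLin k L).rTensor U t) := by
  have hu : u ∈ Algebra.adjoin k (Set.range (ι : L → U)) := by rw [adjoin_ι]; trivial
  induction hu using Algebra.adjoin_induction generalizing t with
  | mem y hy =>
    obtain ⟨x, rfl⟩ := hy
    rw [comulHom_ι, counitHom_ι, zero_smul]
    induction t with
    | zero => simp
    | add a b ha hb => rw [mul_add, map_add, map_add, ha, hb, add_zero]
    | tmul a b =>
      simp [-UniversalEnvelopingAlgebra.ι_apply, add_mul, antipodeLin_mul, antipodeLin_ι,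
        mul_assoc]
  | algebraMap r =>
    simp [Algebra.algebraMap_eq_smul_one]
  | add a b _ _ ha hb =>
    rw [map_add, map_add, add_mul, map_add, map_add, ha, hb, add_smul]
  | mul a b _ _ ha hb =>
    rw [map_mul (comulHom k L), map_mul (counitHom k L), mul_assoc, ha, hb, mul_smul]

theorem antipode_right (u : U) (t : U ⊗[k] U) :
    LinearMap.mul' k U ((antipodeLin k L).lTensor U (t * comulHom k L u)) =
      counitHom k L u • LinearMap.mul' k U ((antipodeLin k L).lTensor U t) := by
  have hu : u ∈ Algebra.adjoin k (Set.range (ι : L → U)) := by rw [adjoin_ι]; trivial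
  induction hu using Algebra.adjoin_induction generalizing t with
  | mem y hy =>
    obtain ⟨x, rfl⟩ := hy
    rw [comulHom_ι, counitHom_ι, zero_smul]
    induction t with
    | zero => simp
    | add a b ha hb => rw [add_mul, map_add, map_add, ha, hb, add_zero]
    | tmul a b =>
      simp [-UniversalEnvelopingAlgebra.ι_apply, mul_add, antipodeLin_mul, antipodeLin_ι,
        mul_assoc]
  | algebraMap r =>
    simp [Algebra.algebraMap_eq_smul_one]
  | add a b _ _ ha hb =>
    rw [map_add, map_add, mul_add, map_add, map_add, ha, hb, add_smul]
  | mul a b _ _ ha hb =>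
    rw [map_mul (comulHom k L), map_mul (counitHom k L), ← mul_assoc, hb, ha, mul_comm, mul_smul]

/-- The standard Hopf algebra structure on the universal enveloping algebra `U(L)`, in which the
elements of `L` are primitive. -/
noncomputable instance : HopfAlgebra k U where
  antipode := antipodeLin k L
  mul_antipode_rTensor_comul := by
    ext u
    have := antipode_left u (1 : U ⊗[k] U)
    rw [mul_one] at this
    refine this.trans ?_
    simp [Algebra.TensorProduct.one_def, antipodeLin_one, Algebra.algebraMap_eq_smul_one]
    rfl
  mul_antipode_lTensor_comul := by
    ext u
    have := antipode_right u (1 : U ⊗[k] U)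
    rw [one_mul] at this
    refine this.trans ?_
    simp [Algebra.TensorProduct.one_def, antipodeLin_one, Algebra.algebraMap_eq_smul_one]
    rfl

/-- The grading on `U(L)` induced by a family `ℒ` of subspaces of `L`: its degree `n` part is
spanned by the products `x₁ ⋯ x_r` with `x_i ∈ ℒ (n_i)` and `n₁ + ⋯ + n_r = n`. -/
noncomputable def grading (ℒ : ℕ → Submodule k L) (n : ℕ) : Submodule k U :=
  Submodule.span k {u | ∃ l : List (ℕ × L), (∀ p ∈ l, p.2 ∈ ℒ p.1) ∧
    (l.map Prod.fst).sum = n ∧ u = (l.map fun p => ι p.2).prod}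

end

end EnvHopf

/-! ### Primitive elements -/

section

variable (k H : Type*) [Field k] [Ring H] [HopfAlgebra k H]

/-- The primitive space `P(H) = {x | Δ x = x ⊗ 1 + 1 ⊗ x}`, a Lie subalgebra of `H` under the
commutator bracket. -/
noncomputable def primitiveSpace : LieSubalgebra k H where
  carrier := {x | Coalgebra.comul (R := k) x = x ⊗ₜ[k] 1 + 1 ⊗ₜ[k] x}
  add_mem' {x y} hx hy := by
    rw [Set.mem_ofPred_eq] at hx hy ⊢
    rw [map_add, hx, hy, TensorProduct.add_tmul, TensorProduct.tmul_add]; abel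
  zero_mem' := by simp
  smul_mem' c x hx := by
    rw [Set.mem_ofPred_eq] at hx ⊢
    rw [map_smul, hx, smul_add, TensorProduct.smul_tmul', TensorProduct.tmul_smul]
  lie_mem' {x y} hx hy := by
    change Coalgebra.comul (R := k) x = _ at hx
    change Coalgebra.comul (R := k) y = _ at hy
    change Coalgebra.comul (R := k) ⁅x, y⁆ = _
    rw [LieRing.of_associative_ring_bracket, map_sub, Bialgebra.comul_mul, Bialgebra.comul_mul,
      hx, hy]
    simp only [add_mul, mul_add, Algebra.TensorProduct.tmul_mul_tmul, mul_one, one_mul,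
      TensorProduct.sub_tmul, TensorProduct.tmul_sub]
    abel

/-- The canonical algebra map `U(P(H)) → H` extending the inclusion `P(H) ⊆ H`. -/
noncomputable def envPrimitiveMap :
    UniversalEnvelopingAlgebra k (primitiveSpace k H) →ₐ[k] H :=
  UniversalEnvelopingAlgebra.lift k (primitiveSpace k H).incl

variable {k H}

/-- The homogeneous parts `P(H) ∩ H_n` of the primitive space. -/
noncomputable def primitiveGrading (𝒜 : ℕ → Submodule k H) (n : ℕ) :
    Submodule k (primitiveSpace k H) :=
  (𝒜 n).comap (primitiveSpace k H).toSubmodule.subtype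

/-! ### Graded Hopf algebras -/

/-- `H = ⨁ H_n` is a graded Hopf algebra: both a graded algebra and a graded coalgebra, with
grading-preserving antipode. -/
structure IsGradedHopfAlgebra (𝒜 : ℕ → Submodule k H) : Prop where
  isInternal : DirectSum.IsInternal 𝒜
  one_mem : (1 : H) ∈ 𝒜 0
  mul_mem : ∀ ⦃i j : ℕ⦄ ⦃a b : H⦄, a ∈ 𝒜 i → b ∈ 𝒜 j → a * b ∈ 𝒜 (i + j)
  comul_mem : ∀ ⦃n : ℕ⦄ ⦃a : H⦄, a ∈ 𝒜 n → Coalgebra.comul (R := k) a ∈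
    ⨆ (i : ℕ) (j : ℕ) (_ : i + j = n),
      LinearMap.range (TensorProduct.map (𝒜 i).subtype (𝒜 j).subtype)
  counit_eq_zero : ∀ ⦃n : ℕ⦄ ⦃a : H⦄, n ≠ 0 → a ∈ 𝒜 n → Coalgebra.counit (R := k) a = 0
  antipode_mem : ∀ ⦃n : ℕ⦄ ⦃a : H⦄, a ∈ 𝒜 n → HopfAlgebra.antipode k a ∈ 𝒜 n

/-- A graded Hopf algebra is connected if `H_0 = k`. -/
structure IsConnectedGradedHopfAlgebra (𝒜 : ℕ → Submodule k H) : Prop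
    extends IsGradedHopfAlgebra 𝒜 where
  connected : 𝒜 0 = Submodule.span k {(1 : H)}

/-- A graded Hopf subalgebra: a subalgebra `B` with `Δ B ⊆ B ⊗ B` and `S B ⊆ B` which is spanned
by its homogeneous elements. -/
structure IsGradedHopfSubalgebra (𝒜 : ℕ → Submodule k H) (B : Subalgebra k H) : Prop where
  comul_mem : ∀ b ∈ B, Coalgebra.comul (R := k) b ∈
    LinearMap.range (TensorProduct.map B.val.toLinearMap B.val.toLinearMap)
  antipode_mem : ∀ b ∈ B, HopfAlgebra.antipode k b ∈ B
  homogeneous : Subalgebra.toSubmodule B ≤ ⨆ n, Subalgebra.toSubmodule B ⊓ 𝒜 n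

/-! ### Ore extensions -/

/-- For subalgebras `B` and `C` of an algebra, `C = B[x; σ, δ]` is an Ore extension of `B`:
`σ` is an automorphism of `B`, `δ` is a `σ`-derivation of `B`, `x b = σ(b) x + δ(b)` for `b ∈ B`,
and `C` is a free left `B`-module with basis `1, x, x², …`. -/
structure IsOreExtension {A : Type*} [Ring A] [Algebra k A] (B C : Subalgebra k A)
    (σ : B ≃ₐ[k] B) (δ : B →ₗ[k] B) (x : A) : Prop where
  le : B ≤ C
  mem : x ∈ C
  map_mul : ∀ a b : B, δ (a * b) = σ a * δ b + δ a * b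
  mul_eq : ∀ b : B, x * b = σ b * x + δ b
  basis : ∀ c ∈ C, ∃! p : ℕ →₀ B, c = p.sum fun i b => (b : A) * x ^ i

/-- `C` is a graded Ore extension of derivation type of `B`: `C = B[x; id, δ]` where `x` is
homogeneous of some degree `m` and `δ` is homogeneous of the same degree. -/
def IsGradedOreExtensionOfDerivationType {A : Type*} [Ring A] [Algebra k A]
    (𝒜 : ℕ → Submodule k A) (B C : Subalgebra k A) : Prop :=
  ∃ (δ : B →ₗ[k] B) (x : A) (m : ℕ), IsOreExtension B C AlgEquiv.refl δ x ∧ x ∈ 𝒜 m ∧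
    ∀ (n : ℕ) (b : B), (b : A) ∈ 𝒜 n → (δ b : A) ∈ 𝒜 (n + m)

/-- The graded Hopf algebra `(H, 𝒜)` is a graded `n`-step iterated Hopf Ore extension of derivation
type of the graded Hopf algebra `(R, ℛ)`, where `R` is regarded as a graded Hopf subalgebra of `H`
through `φ`: there is a chain `φ(R) = C₀ ⊆ C₁ ⊆ ⋯ ⊆ C_n = H` of graded Hopf subalgebras in which
each `C_{i+1}` is a graded Ore extension of derivation type of `C_i`. -/
structure IsGradedIHOEOfDerivationType {R : Type*} [Ring R] [HopfAlgebra k R]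
    (ℛ : ℕ → Submodule k R) (𝒜 : ℕ → Submodule k H) (φ : R →ₐ[k] H) (n : ℕ) : Prop where
  source : IsGradedHopfAlgebra ℛ
  target : IsGradedHopfAlgebra 𝒜
  injective : Function.Injective φ
  map_comul : ∀ r : R, Coalgebra.comul (R := k) (φ r) =
    TensorProduct.map φ.toLinearMap φ.toLinearMap (Coalgebra.comul (R := k) r)
  map_counit : ∀ r : R, Coalgebra.counit (R := k) (φ r) = Coalgebra.counit (R := k) r
  map_antipode : ∀ r : R, HopfAlgebra.antipode k (φ r) = φ (HopfAlgebra.antipode k r)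
  map_mem : ∀ (i : ℕ) (r : R), r ∈ ℛ i → φ r ∈ 𝒜 i
  chain : ∃ C : Fin (n + 1) → Subalgebra k H,
    C 0 = φ.range ∧ C (Fin.last n) = ⊤ ∧ (∀ i, IsGradedHopfSubalgebra 𝒜 (C i)) ∧
      ∀ i : Fin n, IsGradedOreExtensionOfDerivationType 𝒜 (C i.castSucc) (C i.succ)

end

/-! Call `z` relatively primitive over a Hopf subalgebra `A` if `Δz - z ⊗ 1 - 1 ⊗ z ∈ A ⊗ A`.

The engine is a freeness statement, `symbolMap_injective`: in characteristic zero, if such a `z` is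
not in `A`, its powers are left independent over `A`. Suppose `a z^(n+1)` is a combination of words
with at most `n` factors `z`. Apply `Δ`, and project to words with at least `n` factors `z` on the
left and elements outside `A` on the right. Only `(n+1) Δ(a)(zⁿ ⊗ z)` survives, so induction gives
`Δ(a) = 0`. The case of exponent one has to be settled first: the antipode turns a relation `a z ∈
A` into `ε(a) z ∈ A`, hence `ε(a) = 0`, so that `ε` factors through the symbol of exponent one, and
the counit axiom gives `a = 0`.

Consequently a tower of `N` successive adjunctions of homogeneous relatively primitive elements
forces `GKdim H ≥ N`. Towers therefore have length at most `d`, and over a subalgebra `A` in a tower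
the homogeneous relatively primitive elements outside `A` have bounded degree
(`exists_degree_bound`), since otherwise arbitrarily long towers could be built over `A`. If `A ≠
H`, an element of least degree outside `A` is relatively primitive, so a relatively primitive
homogeneous `z ∉ A` of maximal degree exists. For `a ∈ A` of positive degree, `[z, a]` is again
relatively primitive, by induction on the degree of `a`, and has larger degree than `z`; hence it
lies in `A` (`exists_isNormalStep`). Thus `A[z]` is an Ore extension of derivation type. Iterating
reaches `H`.

The same principle applied inside `P(H)`, adjoining primitive elements in decreasing order of
degree, reaches the image of `U(P(H))` from `k` in exactly `dim P(H)` steps and shows at once that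
`U(P(H)) → H` is injective, without the Poincaré–Birkhoff–Witt theorem
(`PrimitiveSegment.exists_step`).

Finally, if `N` normal steps lead from `k` to `H`, the degrees of the adjoined elements are
positive, so the part of degree at most `n` has dimension at most `(n+1)^N` and `GKdim H ≤ N`. With
the lower bound, `N = d`; this counts the steps above `U(P(H))`. -/

/-! ### Tensor products of subspaces and of filtrations. -/

section TensorSubspaces

variable {k H : Type*} [Field k] [Ring H] [Algebra k H]

/-- The subspace `S ⊗ T` of `H ⊗ H`. -/
noncomputable def tens (S T : Submodule k H) : Submodule k (H ⊗[k] H) :=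
  Submodule.map₂ (TensorProduct.mk k H H) S T

theorem tmul_mem_tens {S T : Submodule k H} {x y : H} (hx : x ∈ S) (hy : y ∈ T) :
    x ⊗ₜ[k] y ∈ tens S T :=
  Submodule.apply_mem_map₂ _ hx hy

theorem tens_le {S T : Submodule k H} {W : Submodule k (H ⊗[k] H)} :
    tens S T ≤ W ↔ ∀ x ∈ S, ∀ y ∈ T, x ⊗ₜ[k] y ∈ W :=
  Submodule.map₂_le

theorem tens_mono {S S' T T' : Submodule k H} (hS : S ≤ S') (hT : T ≤ T') :
    tens S T ≤ tens S' T' :=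
  Submodule.map₂_le_map₂ hS hT

theorem range_map_eq_tens {M N : Type*} [AddCommGroup M] [Module k M] [AddCommGroup N]
    [Module k N] (f : M →ₗ[k] H) (g : N →ₗ[k] H) :
    LinearMap.range (TensorProduct.map f g) = tens (LinearMap.range f) (LinearMap.range g) := by
  apply le_antisymm
  · rintro _ ⟨t, rfl⟩
    induction t with
    | zero => simp
    | add a b ha hb => rw [map_add]; exact add_mem ha hb
    | tmul a b => exact tmul_mem_tens ⟨a, rfl⟩ ⟨b, rfl⟩
  · rw [tens_le]
    rintro _ ⟨a, rfl⟩ _ ⟨b, rfl⟩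
    exact ⟨a ⊗ₜ b, rfl⟩

theorem range_map_val (B : Subalgebra k H) :
    LinearMap.range (TensorProduct.map B.val.toLinearMap B.val.toLinearMap) =
      tens (Subalgebra.toSubmodule B) (Subalgebra.toSubmodule B) := by
  rw [range_map_eq_tens]
  have h : LinearMap.range B.val.toLinearMap = Subalgebra.toSubmodule B := by
    ext x; simp
  rw [h]

theorem range_map_subtype (S T : Submodule k H) :
    LinearMap.range (TensorProduct.map S.subtype T.subtype) = tens S T := by
  rw [range_map_eq_tens, Submodule.range_subtype, Submodule.range_subtype]

theorem tens_mul_le (S T S' T' : Submodule k H) :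
    tens S T * tens S' T' ≤ tens (S * S') (T * T') := by
  unfold tens
  rw [Submodule.map₂_eq_span_image2, Submodule.map₂_eq_span_image2 _ S' T', Submodule.span_mul_span,
    Submodule.span_le]
  rintro _ ⟨_, ⟨x, hx, y, hy, rfl⟩, _, ⟨x', hx', y', hy', rfl⟩, rfl⟩
  simp only [TensorProduct.mk_apply, Algebra.TensorProduct.tmul_mul_tmul]
  exact tmul_mem_tens (Submodule.mul_mem_mul hx hx') (Submodule.mul_mem_mul hy hy')

theorem mul_mem_tens (B : Subalgebra k H) {s t : H ⊗[k] H}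
    (hs : s ∈ tens (Subalgebra.toSubmodule B) (Subalgebra.toSubmodule B))
    (ht : t ∈ tens (Subalgebra.toSubmodule B) (Subalgebra.toSubmodule B)) :
    s * t ∈ tens (Subalgebra.toSubmodule B) (Subalgebra.toSubmodule B) := by
  have := tens_mul_le _ _ _ _ (Submodule.mul_mem_mul hs ht)
  rwa [(Subalgebra.isIdempotentElem_toSubmodule B).eq] at this

theorem one_mem_tens (B : Subalgebra k H) :
    (1 : H ⊗[k] H) ∈ tens (Subalgebra.toSubmodule B) (Subalgebra.toSubmodule B) :=
  tmul_mem_tens B.one_mem B.one_mem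

/-- The degree `n` part `∑_{i + j = n} F i ⊗ F j` of the tensor square of a filtration or grading. -/
noncomputable def tensFil (F : ℕ → Submodule k H) (n : ℕ) : Submodule k (H ⊗[k] H) :=
  ⨆ (i : ℕ) (j : ℕ) (_ : i + j = n), tens (F i) (F j)

theorem tens_le_tensFil (F : ℕ → Submodule k H) (i j : ℕ) :
    tens (F i) (F j) ≤ tensFil F (i + j) :=
  le_iSup_of_le i (le_iSup_of_le j (le_iSup_of_le rfl le_rfl))

theorem tensFil_le {F : ℕ → Submodule k H} {n : ℕ} {W : Submodule k (H ⊗[k] H)} :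
    tensFil F n ≤ W ↔ ∀ i j, i + j = n → tens (F i) (F j) ≤ W := by
  simp only [tensFil, iSup_le_iff]

theorem tensFil_mul_le {F : ℕ → Submodule k H} (hF : ∀ i j, F i * F j ≤ F (i + j)) (m n : ℕ) :
    tensFil F m * tensFil F n ≤ tensFil F (m + n) := by
  conv_lhs => unfold tensFil
  simp only [Submodule.iSup_mul, Submodule.mul_iSup, iSup_le_iff]
  rintro i j rfl i' j' rfl
  refine (tens_mul_le _ _ _ _).trans ((tens_mono (hF _ _) (hF _ _)).trans ?_)
  rw [add_add_add_comm]
  exact tens_le_tensFil F _ _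

end TensorSubspaces

/-! ### The filtration by the number of factors `z`. -/

section WordFiltration

variable {k H : Type*} [Field k] [Ring H] [Algebra k H] (A : Subalgebra k H) (z : H)

/-- The span of the products of elements of `A` and at most `n` factors `z`. -/
noncomputable def wordFil (n : ℕ) : Submodule k H :=
  (Subalgebra.toSubmodule A * Submodule.span k {1, z}) ^ n * Subalgebra.toSubmodule A

theorem wordFil_zero : wordFil A z 0 = Subalgebra.toSubmodule A := by
  simp [wordFil]

theorem toSubmodule_mul_wordFil (n : ℕ) :
    Subalgebra.toSubmodule A * wordFil A z n = wordFil A z n := by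
  have h := (Subalgebra.isIdempotentElem_toSubmodule A).eq
  cases n with
  | zero => rw [wordFil_zero, h]
  | succ n => rw [wordFil, pow_succ', ← mul_assoc, ← mul_assoc, ← mul_assoc, h]

/-- The two inner copies of `A` merge because `A * A = A`. Words are used instead of sums `∑ A zⁱ`
because `z` is not assumed to normalize `A`, so that those sums need not be closed under
multiplication. -/
theorem wordFil_mul (i j : ℕ) : wordFil A z i * wordFil A z j = wordFil A z (i + j) := by
  conv_lhs => rw [wordFil, mul_assoc, toSubmodule_mul_wordFil]
  rw [wordFil, wordFil, pow_add, mul_assoc]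

theorem one_mem_wordFil (n : ℕ) : (1 : H) ∈ wordFil A z n := by
  have h1 : (1 : Submodule k H) ≤ Subalgebra.toSubmodule A * Submodule.span k {1, z} := by
    rw [Submodule.one_le, ← one_mul (1 : H)]
    exact Submodule.mul_mem_mul A.one_mem (Submodule.subset_span (by simp))
  have h2 : (1 : Submodule k H) ≤ Subalgebra.toSubmodule A := Submodule.one_le.2 A.one_mem
  rw [← Submodule.one_le]
  calc (1 : Submodule k H) = 1 ^ n * 1 := by simp
    _ ≤ _ := mul_le_mul' (pow_le_pow_left' h1 n) h2

theorem wordFil_mono : Monotone (wordFil A z) := by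
  intro i j hij
  obtain ⟨l, rfl⟩ := Nat.exists_eq_add_of_le hij
  rw [← wordFil_mul]
  intro x hx
  rw [← mul_one x]
  exact Submodule.mul_mem_mul hx (one_mem_wordFil A z l)

theorem self_mem_wordFil : z ∈ wordFil A z 1 := by
  rw [wordFil, pow_one, ← mul_one z, ← one_mul z]
  exact Submodule.mul_mem_mul (Submodule.mul_mem_mul A.one_mem (Submodule.subset_span (by simp)))
    A.one_mem

theorem pow_mem_wordFil (n : ℕ) : z ^ n ∈ wordFil A z n := by
  induction n with
  | zero => simpa using one_mem_wordFil A z 0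
  | succ n ih =>
    rw [pow_succ, ← wordFil_mul]
    exact Submodule.mul_mem_mul ih (self_mem_wordFil A z)

theorem mul_mem_wordFil {a x : H} (ha : a ∈ A) {n : ℕ} (hx : x ∈ wordFil A z n) :
    a * x ∈ wordFil A z n := by
  rw [← toSubmodule_mul_wordFil]
  exact Submodule.mul_mem_mul ha hx

theorem mul_pow_mem_wordFil {a : H} (ha : a ∈ A) (n : ℕ) : a * z ^ n ∈ wordFil A z n :=
  mul_mem_wordFil A z ha (pow_mem_wordFil A z n)

/-- The words with fewer than `n` factors `z`. -/
noncomputable def wordFilLT : ℕ → Submodule k H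
  | 0 => ⊥
  | n + 1 => wordFil A z n

/-- The map `a ↦ a z ^ n` from `A` to `H` modulo words with fewer than `n` factors `z`. -/
noncomputable def symbolMap (n : ℕ) : A →ₗ[k] H ⧸ wordFilLT A z n :=
  (wordFilLT A z n).mkQ ∘ₗ LinearMap.mulRight k (z ^ n) ∘ₗ A.val.toLinearMap

theorem symbolMap_apply (n : ℕ) (a : A) :
    symbolMap A z n a = (wordFilLT A z n).mkQ (a * z ^ n) := rfl

end WordFiltration

/-! ### Relatively primitive elements and the coproduct of words. -/

section Freeness

variable {k H : Type*} [Field k] [Ring H] [HopfAlgebra k H]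

variable (k H) in
/-- The map `x ↦ Δ x - x ⊗ 1 - 1 ⊗ x`. -/
noncomputable def redComul : H →ₗ[k] H ⊗[k] H :=
  Coalgebra.comul - (TensorProduct.mk k H H).flip 1 - TensorProduct.mk k H H 1

theorem redComul_apply (x : H) :
    redComul k H x = Coalgebra.comul (R := k) x - x ⊗ₜ 1 - 1 ⊗ₜ x := rfl

theorem comul_eq_add_redComul (x : H) :
    Coalgebra.comul (R := k) x = (x ⊗ₜ 1 + 1 ⊗ₜ x) + redComul k H x := by
  rw [redComul_apply]; abel

/-- A subalgebra is a Hopf subalgebra. -/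
structure IsHopfSub (A : Subalgebra k H) : Prop where
  comul_mem : ∀ a ∈ A, Coalgebra.comul (R := k) a ∈
    tens (Subalgebra.toSubmodule A) (Subalgebra.toSubmodule A)
  antipode_mem : ∀ a ∈ A, HopfAlgebra.antipode k a ∈ A

/-- The elements which are primitive modulo `A ⊗ A`. -/
noncomputable def relPrim (A : Subalgebra k H) : Submodule k H :=
  (tens (Subalgebra.toSubmodule A) (Subalgebra.toSubmodule A)).comap (redComul k H)

variable {A : Subalgebra k H} {z : H}

theorem comul_mem_tensFil_one (hz : z ∈ relPrim A) :
    Coalgebra.comul (R := k) z ∈ tensFil (wordFil A z) 1 := by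
  rw [comul_eq_add_redComul]
  refine add_mem (add_mem ?_ ?_) ?_
  · exact tens_le_tensFil _ 1 0 (tmul_mem_tens (self_mem_wordFil A z) (one_mem_wordFil A z 0))
  · exact tens_le_tensFil _ 0 1 (tmul_mem_tens (one_mem_wordFil A z 0) (self_mem_wordFil A z))
  · refine tens_le_tensFil _ 1 0 ?_
    rw [wordFil_zero]
    refine tens_mono ?_ le_rfl hz
    rw [← wordFil_zero A z]
    exact wordFil_mono A z zero_le_one

/-- `Δ` is an algebra map sending `A` to filtration degree 0 and `z` to filtration degree 1 of the
tensor square, and the filtration of the tensor square is multiplicative. -/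
theorem comul_wordFil_le (hA : IsHopfSub A) (hz : z ∈ relPrim A) (n : ℕ) :
    (wordFil A z n).map (Bialgebra.comulAlgHom k H).toLinearMap ≤ tensFil (wordFil A z) n := by
  have hF : ∀ i j, wordFil A z i * wordFil A z j ≤ wordFil A z (i + j) :=
    fun i j => (wordFil_mul A z i j).le
  have hA0 : (Subalgebra.toSubmodule A).map (Bialgebra.comulAlgHom k H).toLinearMap ≤
      tensFil (wordFil A z) 0 := by
    rintro _ ⟨a, ha, rfl⟩
    refine tens_le_tensFil _ 0 0 ?_
    rw [wordFil_zero]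
    exact hA.comul_mem a ha
  have hZ : (Submodule.span k {1, z}).map (Bialgebra.comulAlgHom k H).toLinearMap ≤
      tensFil (wordFil A z) 1 := by
    rw [Submodule.map_span_le]
    rintro x (rfl | rfl)
    · refine tens_le_tensFil _ 1 0 ?_
      simp only [AlgHom.toLinearMap_apply, map_one]
      exact tmul_mem_tens (one_mem_wordFil A z _) (one_mem_wordFil A z _)
    · exact comul_mem_tensFil_one hz
  have hpow : ∀ n, ((Subalgebra.toSubmodule A * Submodule.span k {1, z}).map
      (Bialgebra.comulAlgHom k H).toLinearMap) ^ n * tensFil (wordFil A z) 0 ≤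
      tensFil (wordFil A z) n := by
    intro n
    induction n with
    | zero => simp
    | succ n ih =>
      rw [pow_succ', mul_assoc, add_comm]
      refine (mul_le_mul' ?_ ih).trans (tensFil_mul_le hF 1 n)
      rw [Submodule.map_mul]
      exact (mul_le_mul' hA0 hZ).trans (tensFil_mul_le hF 0 1)
  rw [wordFil, Submodule.map_mul, Submodule.map_pow]
  exact (mul_le_mul' le_rfl hA0).trans (hpow n)

/-- Replacing `Δz` by its leading part `z ⊗ 1 + 1 ⊗ z` inside a power costs only terms of lower
filtration degree; here `w` plays the role of `redComul k H z`. -/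
theorem pow_add_sub_pow_mem {R : Type*} [Ring R] [Algebra k R] (G : ℕ → Submodule k R)
    (hG : ∀ i j, G i * G j ≤ G (i + j)) (h1 : (1 : R) ∈ G 0) {x w : R} (hx : x ∈ G 1)
    (hw : w ∈ G 0) (hle : G 0 ≤ G 1) (n : ℕ) : (x + w) ^ (n + 1) - x ^ (n + 1) ∈ G n := by
  have hp : ∀ n, (x + w) ^ n ∈ G n := by
    intro n
    induction n with
    | zero => simpa using h1
    | succ n ih =>
      rw [pow_succ]
      exact hG n 1 (Submodule.mul_mem_mul ih (add_mem hx (hle hw)))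
  induction n with
  | zero => simpa using hw
  | succ n ih =>
    have : (x + w) ^ (n + 1 + 1) - x ^ (n + 1 + 1) =
        ((x + w) ^ (n + 1) - x ^ (n + 1)) * x + (x + w) ^ (n + 1) * w := by
      rw [pow_succ (x + w) (n + 1), pow_succ x (n + 1)]; noncomm_ring
    rw [this]
    exact add_mem (hG n 1 (Submodule.mul_mem_mul ih hx))
      (hG (n + 1) 0 (Submodule.mul_mem_mul (hp (n + 1)) hw))

end Freeness

/-! ### Freeness of the powers of a relatively primitive element. -/

section Freeness

variable {k H : Type*} [Field k] [Ring H] [HopfAlgebra k H] {A : Subalgebra k H} {z : H}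

theorem wordFilLT_le (A : Subalgebra k H) (z : H) {i n : ℕ} (h : i < n) :
    wordFil A z i ≤ wordFilLT A z n := by
  cases n with
  | zero => omega
  | succ n => exact wordFil_mono A z (Nat.lt_succ_iff.1 h)

/-- The projection of `H ⊗ H` to the tensor product of the quotient by words with fewer than `n`
factors `z` and the quotient by `A`. -/
noncomputable def symbolProj (A : Subalgebra k H) (z : H) (n : ℕ) :
    H ⊗[k] H →ₗ[k] (H ⧸ wordFilLT A z n) ⊗[k] (H ⧸ wordFilLT A z 1) :=
  TensorProduct.map (wordFilLT A z n).mkQ (wordFilLT A z 1).mkQ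

theorem symbolProj_left {n : ℕ} {x : H} (y : H) (hx : x ∈ wordFilLT A z n) :
    symbolProj A z n (x ⊗ₜ y) = 0 := by
  rw [symbolProj, TensorProduct.map_tmul, Submodule.mkQ_apply,
    (Submodule.Quotient.mk_eq_zero _).2 hx, TensorProduct.zero_tmul]

theorem symbolProj_right (n : ℕ) (x : H) {y : H} (hy : y ∈ A) :
    symbolProj A z n (x ⊗ₜ y) = 0 := by
  have hy' : y ∈ wordFilLT A z 1 := by
    change y ∈ wordFil A z 0
    rwa [wordFil_zero]
  rw [symbolProj, TensorProduct.map_tmul, Submodule.mkQ_apply _ y,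
    (Submodule.Quotient.mk_eq_zero _).2 hy', TensorProduct.tmul_zero]

/-- In `F i ⊗ F j` with `i + j = n`, either `j = 0` and the right factor lies in `A`, or `i < n` and
the left factor has too few `z`. -/
theorem symbolProj_tensFil {n : ℕ} {t : H ⊗[k] H} (ht : t ∈ tensFil (wordFil A z) n) :
    symbolProj A z n t = 0 := by
  suffices h : tensFil (wordFil A z) n ≤ LinearMap.ker (symbolProj A z n) from h ht
  rw [tensFil_le]
  intro i j hij
  rw [tens_le]
  intro x hx y hy
  rw [LinearMap.mem_ker]
  rcases Nat.eq_zero_or_pos j with rfl | hj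
  · exact symbolProj_right n x (by rwa [wordFil_zero] at hy)
  · exact symbolProj_left y (wordFilLT_le A z (by omega) hx)

theorem symbolProj_mul_monomial {s : H ⊗[k] H}
    (hs : s ∈ tens (Subalgebra.toSubmodule A) (Subalgebra.toSubmodule A)) {n m : ℕ}
    (hm : m ≤ n + 1) (hmn : m ≠ n) :
    symbolProj A z n (s * (z ^ m) ⊗ₜ (z ^ (n + 1 - m))) = 0 := by
  suffices h : tens (Subalgebra.toSubmodule A) (Subalgebra.toSubmodule A) ≤
      LinearMap.ker (symbolProj A z n ∘ₗ
        LinearMap.mulRight k ((z ^ m) ⊗ₜ[k] (z ^ (n + 1 - m)))) from h hs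
  rw [tens_le]
  intro x hx y hy
  rw [LinearMap.mem_ker, LinearMap.comp_apply, LinearMap.mulRight_apply,
    Algebra.TensorProduct.tmul_mul_tmul]
  rcases Nat.lt_or_gt_of_ne hmn with h | h
  · exact symbolProj_left _ (wordFilLT_le A z h (mul_pow_mem_wordFil A z hx m))
  · obtain rfl : m = n + 1 := by omega
    exact symbolProj_right n _ (by simpa using hy)

/-- In the binomial expansion the terms with `m < n` die in the left quotient and the term `m = n +
1` dies in the right one. Only `m = n` is left, with coefficient `n + 1`. -/
theorem symbolProj_mul_pow {s : H ⊗[k] H}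
    (hs : s ∈ tens (Subalgebra.toSubmodule A) (Subalgebra.toSubmodule A)) (n : ℕ) :
    symbolProj A z n (s * (z ⊗ₜ 1 + 1 ⊗ₜ z) ^ (n + 1)) =
      (n + 1 : k) • symbolProj A z n (s * (z ^ n) ⊗ₜ z) := by
  have hc : Commute (z ⊗ₜ[k] (1 : H)) ((1 : H) ⊗ₜ[k] z) := by
    simp [Commute, SemiconjBy]
  have hterm : ∀ m : ℕ, s * ((z ⊗ₜ[k] (1 : H)) ^ m * ((1 : H) ⊗ₜ[k] z) ^ (n + 1 - m) *
      ((n + 1).choose m : H ⊗[k] H)) =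
      ((n + 1).choose m : k) • (s * (z ^ m) ⊗ₜ (z ^ (n + 1 - m))) := by
    intro m
    rw [Algebra.TensorProduct.tmul_pow, Algebra.TensorProduct.tmul_pow, one_pow, one_pow,
      Algebra.TensorProduct.tmul_mul_tmul, one_mul, mul_one, ← nsmul_eq_mul', mul_smul_comm,
      Nat.cast_smul_eq_nsmul]
  rw [hc.add_pow, Finset.mul_sum, map_sum, Finset.sum_eq_single n]
  · rw [hterm, map_smul, Nat.choose_succ_self_right]
    simp
  · intro m hm hmn
    rw [hterm, map_smul, symbolProj_mul_monomial hs (by simpa [Nat.lt_succ_iff] using hm) hmn,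
      smul_zero]
  · intro h
    simp at h

/-- The inductive mechanism: a relation for `a z^(n+1)` is turned by `Δ` into a relation for the
pair of symbols of exponents `n` and `1` on the two legs of `Δ(a)`. -/
theorem map_symbolMap_eq_zero [CharZero k] (hA : IsHopfSub A) (hz : z ∈ relPrim A) {n : ℕ} {a : A}
    (ha : symbolMap A z (n + 1) a = 0) {t : A ⊗[k] A}
    (ht : TensorProduct.map A.val.toLinearMap A.val.toLinearMap t =
      Coalgebra.comul (R := k) (a : H)) :
    TensorProduct.map (symbolMap A z n) (symbolMap A z 1) t = 0 := by
  have hG := tensFil_mul_le (fun i j => (wordFil_mul A z i j).le)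
  have hAG : tens (Subalgebra.toSubmodule A) (Subalgebra.toSubmodule A) ≤
      tensFil (wordFil A z) 0 := by
    have := tens_le_tensFil (wordFil A z) 0 0
    rwa [wordFil_zero] at this
  have hle : tensFil (wordFil A z) 0 ≤ tensFil (wordFil A z) 1 := by
    rw [tensFil_le]
    rintro i j hij
    obtain ⟨rfl, rfl⟩ : i = 0 ∧ j = 0 := by omega
    exact (tens_mono (wordFil_mono A z zero_le_one) le_rfl).trans (tens_le_tensFil _ 1 0)
  have hX : z ⊗ₜ[k] (1 : H) + (1 : H) ⊗ₜ[k] z ∈ tensFil (wordFil A z) 1 :=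
    add_mem (tens_le_tensFil _ 1 0
        (tmul_mem_tens (self_mem_wordFil A z) (one_mem_wordFil A z 0)))
      (tens_le_tensFil _ 0 1 (tmul_mem_tens (one_mem_wordFil A z 0) (self_mem_wordFil A z)))
  have h1 : Coalgebra.comul (R := k) ((a : H) * z ^ (n + 1)) ∈ tensFil (wordFil A z) n := by
    apply comul_wordFil_le hA hz n
    refine ⟨_, ?_, rfl⟩
    rw [symbolMap_apply, Submodule.mkQ_apply, Submodule.Quotient.mk_eq_zero] at ha
    exact ha
  have hs := hA.comul_mem a a.2
  have h2 : Coalgebra.comul (R := k) (a : H) *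
      ((z ⊗ₜ[k] (1 : H) + (1 : H) ⊗ₜ[k] z + redComul k H z) ^ (n + 1) -
        (z ⊗ₜ[k] (1 : H) + (1 : H) ⊗ₜ[k] z) ^ (n + 1)) ∈ tensFil (wordFil A z) n := by
    have := hG 0 n (Submodule.mul_mem_mul (hAG hs) (pow_add_sub_pow_mem (tensFil (wordFil A z)) hG
      (hAG (one_mem_tens A)) hX (hAG hz) hle n))
    rwa [zero_add] at this
  rw [← comul_eq_add_redComul, mul_sub, ← Bialgebra.comul_pow, ← Bialgebra.comul_mul] at h2
  have h3 := symbolProj_tensFil ((Submodule.sub_mem_iff_right _ h1).1 h2)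
  rw [symbolProj_mul_pow hs, smul_eq_zero] at h3
  -- Characteristic zero enters here: `n + 1` is invertible in `k`.
  have h4 := h3.resolve_left (by exact_mod_cast Nat.succ_ne_zero n)
  rw [← ht] at h4
  rw [← h4]
  have : TensorProduct.map (symbolMap A z n) (symbolMap A z 1) =
      symbolProj A z n ∘ₗ LinearMap.mulRight k ((z ^ n) ⊗ₜ[k] z) ∘ₗ
        TensorProduct.map A.val.toLinearMap A.val.toLinearMap := by
    ext x y
    simp [symbolProj, symbolMap]
  rw [this]
  rfl

theorem exists_map_val_eq_comul (hA : IsHopfSub A) (a : A) : ∃ t : A ⊗[k] A,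
    TensorProduct.map A.val.toLinearMap A.val.toLinearMap t = Coalgebra.comul (R := k) (a : H) := by
  have h := hA.comul_mem a a.2
  rw [← range_map_val] at h
  exact h

theorem symbolMap_zero_injective : Function.Injective (symbolMap A z 0) := by
  intro a b hab
  rw [symbolMap_apply, symbolMap_apply, ← sub_eq_zero, ← map_sub, Submodule.mkQ_apply,
    Submodule.Quotient.mk_eq_zero] at hab
  simpa [wordFilLT, sub_eq_zero] using hab

/-- The case `n = 0` of the mechanism, where the symbol of exponent `0` is just the inclusion of `A`
and can be cancelled by flatness over a field. -/
theorem lTensor_symbolMap_eq_zero [CharZero k] (hA : IsHopfSub A) (hz : z ∈ relPrim A) {a : A}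
    (ha : symbolMap A z 1 a = 0) {t : A ⊗[k] A}
    (ht : TensorProduct.map A.val.toLinearMap A.val.toLinearMap t =
      Coalgebra.comul (R := k) (a : H)) :
    LinearMap.lTensor A (symbolMap A z 1) t = 0 := by
  have h := map_symbolMap_eq_zero hA hz (n := 0) ha ht
  have hinj : Function.Injective (LinearMap.rTensor (H ⧸ wordFilLT A z 1) (symbolMap A z 0)) :=
    Module.Flat.rTensor_preserves_injective_linearMap _ symbolMap_zero_injective
  apply hinj
  rw [map_zero, ← LinearMap.comp_apply, LinearMap.rTensor_comp_lTensor]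
  exact h

/-- From `∑ a₁ ⊗ a₂ z ≡ 0` modulo `A` in the second leg, applying `S` to the first leg and
multiplying gives `∑ S(a₁) a₂ z = ε(a) z ∈ A`. As `z ∉ A`, this forces `ε(a) = 0`. -/
theorem counit_eq_zero_of_symbolMap_one [CharZero k] (hA : IsHopfSub A) (hz : z ∈ relPrim A)
    (hzA : z ∉ A) {a : A} (ha : symbolMap A z 1 a = 0) : Coalgebra.counit (R := k) (a : H) = 0 := by
  obtain ⟨t, ht⟩ := exists_map_val_eq_comul hA a
  have h := lTensor_symbolMap_eq_zero hA hz ha ht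
  let N : Submodule k H := wordFilLT A z 1
  -- Left multiplication by `S(x)` must descend to the quotient by `A`; this is where stability of
  -- `A` under the antipode is used.
  have hN : ∀ x : A, N ≤ N.comap (LinearMap.mulLeft k (HopfAlgebra.antipode k (x : H))) := by
    intro x y hy
    exact mul_mem_wordFil A z (hA.antipode_mem x x.2) hy
  let μ : A →ₗ[k] (H ⧸ N) →ₗ[k] (H ⧸ N) :=
    { toFun := fun x => N.mapQ N (LinearMap.mulLeft k (HopfAlgebra.antipode k (x : H))) (hN x)
      map_add' := fun x y => by
        ext u
        simp [add_mul]
      map_smul' := fun c x => by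
        ext u
        simp }
  have key : TensorProduct.lift μ ∘ₗ LinearMap.lTensor A (symbolMap A z 1) =
      N.mkQ ∘ₗ LinearMap.mulRight k z ∘ₗ LinearMap.mul' k H ∘ₗ
        (HopfAlgebra.antipode k).rTensor H ∘ₗ
          TensorProduct.map A.val.toLinearMap A.val.toLinearMap := by
    ext x y
    simp [symbolMap, μ, mul_assoc, N]
  have h2 := congrArg (fun f => f t) key
  simp only [LinearMap.comp_apply, h, map_zero, ht, HopfAlgebra.mul_antipode_rTensor_comul_apply,
    LinearMap.mulRight_apply] at h2
  have h3 := (Submodule.Quotient.mk_eq_zero _).1 h2.symm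
  change _ ∈ wordFil A z 0 at h3
  rw [wordFil_zero, ← Algebra.smul_def] at h3
  by_contra hne
  exact hzA (((Subalgebra.toSubmodule A).smul_mem_iff hne).1 h3)

/-- The counit kills the kernel of the symbol map, so over a field it factors as `l ∘ symbolMap A z
1`. The second leg of `Δ(a)` is killed by the symbol, hence by `ε`, and the counit axiom returns `a
= 0`. -/
theorem symbolMap_one_injective [CharZero k] (hA : IsHopfSub A) (hz : z ∈ relPrim A)
    (hzA : z ∉ A) : Function.Injective (symbolMap A z 1) := by
  rw [injective_iff_map_eq_zero]
  intro a ha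
  obtain ⟨t, ht⟩ := exists_map_val_eq_comul hA a
  have h := lTensor_symbolMap_eq_zero hA hz ha ht
  let ε : Module.Dual k A := Coalgebra.counit ∘ₗ A.val.toLinearMap
  have hε : ε ∈ LinearMap.range (symbolMap A z 1).dualMap := by
    rw [LinearMap.range_dualMap_eq_dualAnnihilator_ker, Submodule.mem_dualAnnihilator]
    intro x hx
    exact counit_eq_zero_of_symbolMap_one hA hz hzA hx
  obtain ⟨l, hl⟩ := hε
  have h2 : LinearMap.lTensor A ε t = 0 := by
    rw [← hl, LinearMap.dualMap_apply', LinearMap.lTensor_comp, LinearMap.comp_apply, h, map_zero]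
  have h3 : LinearMap.lTensor H Coalgebra.counit
      (TensorProduct.map A.val.toLinearMap A.val.toLinearMap t) =
      LinearMap.rTensor k A.val.toLinearMap (LinearMap.lTensor A ε t) := by
    rw [← LinearMap.comp_apply, ← LinearMap.comp_apply]
    congr 1
    ext x y
    simp [ε]
  rw [ht, h2, map_zero, Coalgebra.lTensor_counit_comul] at h3
  have h4 := congrArg (TensorProduct.rid k H) h3
  simpa using h4

/-- If `z ∉ A` is primitive modulo `A ⊗ A` for a Hopf subalgebra `A`, then no nonzero element `a` of
`A` makes `a z ^ n` a combination of words with fewer than `n` factors `z`. -/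
theorem symbolMap_injective [CharZero k] (hA : IsHopfSub A) (hz : z ∈ relPrim A)
    (hzA : z ∉ A) (n : ℕ) : Function.Injective (symbolMap A z n) := by
  induction n with
  | zero => exact symbolMap_zero_injective
  | succ n ih =>
    rw [injective_iff_map_eq_zero]
    intro a ha
    obtain ⟨t, ht⟩ := exists_map_val_eq_comul hA a
    have h := map_symbolMap_eq_zero hA hz ha ht
    have hinj : Function.Injective (TensorProduct.map (symbolMap A z n) (symbolMap A z 1)) := by
      rw [← LinearMap.rTensor_comp_lTensor]
      exact (Module.Flat.rTensor_preserves_injective_linearMap _ ih).comp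
        (Module.Flat.lTensor_preserves_injective_linearMap _ (symbolMap_one_injective hA hz hzA))
    have ht0 : t = 0 := hinj (by rw [h, map_zero])
    rw [ht0, map_zero] at ht
    have := Coalgebra.lTensor_counit_comul (R := k) (a : H)
    rw [← ht, map_zero] at this
    have h4 := congrArg (TensorProduct.rid k H) this
    simpa using h4.symm

theorem eq_zero_of_sum_mul_pow_eq_zero [CharZero k] (hA : IsHopfSub A) (hz : z ∈ relPrim A)
    (hzA : z ∉ A) (n : ℕ) (b : ℕ → A) (h : ∑ i ∈ Finset.range n, (b i : H) * z ^ i = 0) :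
    ∀ i < n, b i = 0 := by
  induction n with
  | zero => intro i hi; omega
  | succ n ih =>
    have hn : b n = 0 := by
      apply symbolMap_injective hA hz hzA n
      rw [map_zero, symbolMap_apply, Submodule.mkQ_apply, Submodule.Quotient.mk_eq_zero]
      rw [Finset.sum_range_succ, add_comm, add_eq_zero_iff_eq_neg] at h
      rw [h]
      refine neg_mem (sum_mem fun i hi => ?_)
      exact wordFilLT_le A z (Finset.mem_range.1 hi) (mul_pow_mem_wordFil A z (b i).2 i)
    intro i hi
    rcases Nat.lt_succ_iff_lt_or_eq.1 hi with hi | rfl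
    · refine ih ?_ i hi
      rw [Finset.sum_range_succ, hn] at h
      simpa using h
    · exact hn

end Freeness

/-! ### Homogeneous components in `H` and in `H ⊗ H`. -/

section Projections

variable {k H : Type*} [Field k] [Ring H] [Algebra k H] {𝒜 : ℕ → Submodule k H}
  (h : DirectSum.IsInternal 𝒜)

/-- The projection onto the degree `n` part. -/
noncomputable def gproj (n : ℕ) : H →ₗ[k] H :=
  (𝒜 n).subtype ∘ₗ DirectSum.component k ℕ (fun i => 𝒜 i) n ∘ₗ
    (LinearEquiv.ofBijective (DirectSum.coeLinearMap 𝒜) h).symm.toLinearMap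

theorem gproj_mem (n : ℕ) (x : H) : gproj h n x ∈ 𝒜 n := Subtype.property _

theorem ofBijective_symm_of_mem {n : ℕ} {x : H} (hx : x ∈ 𝒜 n) :
    (LinearEquiv.ofBijective (DirectSum.coeLinearMap 𝒜) h).symm x =
      DirectSum.lof k ℕ (fun i => 𝒜 i) n ⟨x, hx⟩ := by
  rw [LinearEquiv.symm_apply_eq]
  exact (DirectSum.coeLinearMap_lof 𝒜 n ⟨x, hx⟩).symm

theorem gproj_of_mem {n : ℕ} {x : H} (hx : x ∈ 𝒜 n) : gproj h n x = x := by
  simp [gproj, ofBijective_symm_of_mem h hx, DirectSum.component.lof_self]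

theorem gproj_of_mem_ne {m n : ℕ} (hmn : m ≠ n) {x : H} (hx : x ∈ 𝒜 m) : gproj h n x = 0 := by
  simp [gproj, ofBijective_symm_of_mem h hx, DirectSum.component.of, hmn]

include h in
theorem homogeneous_induction {p : H → Prop} (x : H) (hmem : ∀ n, ∀ y ∈ 𝒜 n, p y)
    (hadd : ∀ y z, p y → p z → p (y + z)) : p x := by
  have hx : x ∈ ⨆ n, 𝒜 n := by rw [h.submodule_iSup_eq_top]; trivial
  exact Submodule.iSup_induction 𝒜 (motive := p) hx hmem (hmem 0 0 (zero_mem _)) hadd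

theorem exists_eq_sum_gproj (x : H) : ∃ N, ∀ M, N ≤ M → ∑ i ∈ Finset.range M, gproj h i x = x := by
  induction x using homogeneous_induction h with
  | hmem n y hy =>
    refine ⟨n + 1, fun M hM => ?_⟩
    rw [Finset.sum_eq_single n, gproj_of_mem h hy]
    · intro i _ hi
      exact gproj_of_mem_ne h hi.symm hy
    · intro hn
      simp at hn
      omega
  | hadd y z hy hz =>
    obtain ⟨N, hN⟩ := hy
    obtain ⟨N', hN'⟩ := hz
    refine ⟨max N N', fun M hM => ?_⟩
    simp only [map_add, Finset.sum_add_distrib, hN M (le_of_max_le_left hM),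
      hN' M (le_of_max_le_right hM)]

/-- A subspace spanned by homogeneous elements. -/
def IsHomog (S : Submodule k H) : Prop := ∀ n, ∀ x ∈ S, gproj h n x ∈ S

theorem le_iSup_inf_of_isHomog {S : Submodule k H} (hS : IsHomog h S) : S ≤ ⨆ n, S ⊓ 𝒜 n := by
  intro x hx
  obtain ⟨N, hN⟩ := exists_eq_sum_gproj h x
  rw [← hN N le_rfl]
  exact sum_mem fun i _ => Submodule.mem_iSup_of_mem i ⟨hS i x hx, gproj_mem h i x⟩

theorem mem_of_forall_gproj_mem {S : Submodule k H} {x : H} (hx : ∀ n, gproj h n x ∈ S) :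
    x ∈ S := by
  obtain ⟨N, hN⟩ := exists_eq_sum_gproj h x
  rw [← hN N le_rfl]
  exact sum_mem fun i _ => hx i

theorem IsHomog.sup {S T : Submodule k H} (hS : IsHomog h S) (hT : IsHomog h T) :
    IsHomog h (S ⊔ T) := by
  intro n x hx
  obtain ⟨y, hy, z, hz, rfl⟩ := Submodule.mem_sup.1 hx
  rw [map_add]
  exact Submodule.add_mem_sup (hS n y hy) (hT n z hz)

theorem isHomog_span_singleton {n : ℕ} {x : H} (hx : x ∈ 𝒜 n) :
    IsHomog h (Submodule.span k {x}) := by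
  intro i y hy
  obtain ⟨c, rfl⟩ := Submodule.mem_span_singleton.1 hy
  rw [map_smul]
  refine Submodule.smul_mem _ _ ?_
  by_cases hi : n = i
  · subst hi
    rw [gproj_of_mem h hx]
    exact Submodule.mem_span_singleton_self x
  · rw [gproj_of_mem_ne h hi hx]
    exact zero_mem _

/-- An element outside a subspace has a homogeneous component outside it. -/
theorem exists_gproj_notMem {S : Submodule k H} {x : H} (hx : x ∉ S) : ∃ n, gproj h n x ∉ S := by
  by_contra! hc
  exact hx (mem_of_forall_gproj_mem h hc)

/-- The projection onto the degree `n` part of the tensor square. -/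
noncomputable def tproj (n : ℕ) : H ⊗[k] H →ₗ[k] H ⊗[k] H :=
  ∑ p ∈ Finset.HasAntidiagonal.antidiagonal n, TensorProduct.map (gproj h p.1) (gproj h p.2)

theorem tproj_tmul_of_mem {i j : ℕ} {x y : H} (hx : x ∈ 𝒜 i) (hy : y ∈ 𝒜 j) (n : ℕ) :
    tproj h n (x ⊗ₜ y) = if i + j = n then x ⊗ₜ y else 0 := by
  rw [tproj, LinearMap.sum_apply]
  split_ifs with hij
  · rw [Finset.sum_eq_single (i, j)]
    · simp [gproj_of_mem h hx, gproj_of_mem h hy]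
    · rintro ⟨a, b⟩ hab hne
      rw [Finset.HasAntidiagonal.mem_antidiagonal] at hab
      have : i ≠ a := by
        rintro rfl
        simp only at hab
        exact hne (Prod.ext rfl (show b = j by omega))
      simp [gproj_of_mem_ne h this hx]
    · intro hc
      simp [hij] at hc
  · refine Finset.sum_eq_zero ?_
    rintro ⟨a, b⟩ hab
    rw [Finset.HasAntidiagonal.mem_antidiagonal] at hab
    by_cases hia : i = a
    · have : j ≠ b := by
        simp only at hab
        omega
      simp [gproj_of_mem_ne h this hy]
    · simp [gproj_of_mem_ne h hia hx]

theorem tproj_of_mem_tensFil {m : ℕ} {t : H ⊗[k] H} (ht : t ∈ tensFil 𝒜 m) (n : ℕ) :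
    tproj h n t = if m = n then t else 0 := by
  suffices hle : tensFil 𝒜 m ≤
      LinearMap.ker (tproj h n - if m = n then LinearMap.id else 0) by
    have := hle ht
    rw [LinearMap.mem_ker, LinearMap.sub_apply, sub_eq_zero] at this
    rw [this]
    split_ifs <;> rfl
  rw [tensFil_le]
  rintro i j rfl
  rw [tens_le]
  intro x hx y hy
  rw [LinearMap.mem_ker, LinearMap.sub_apply, tproj_tmul_of_mem h hx hy]
  split_ifs <;> simp

theorem tproj_mem_tens {S : Submodule k H} (hS : IsHomog h S) (n : ℕ) {t : H ⊗[k] H}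
    (ht : t ∈ tens S S) : tproj h n t ∈ tens S S := by
  suffices hle : tens S S ≤ (tens S S).comap (tproj h n) from hle ht
  rw [tens_le]
  intro x hx y hy
  rw [Submodule.mem_comap, tproj, LinearMap.sum_apply]
  exact sum_mem fun p _ => tmul_mem_tens (hS _ x hx) (hS _ y hy)

end Projections

/-! ### Compatibility of the coproduct with degrees. -/

section GradedHopf

variable {k H : Type*} [Field k] [Ring H] [HopfAlgebra k H] {𝒜 : ℕ → Submodule k H}

theorem comul_gproj (h𝒜 : IsGradedHopfAlgebra 𝒜) (n : ℕ) (x : H) :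
    Coalgebra.comul (R := k) (gproj h𝒜.isInternal n x) =
      tproj h𝒜.isInternal n (Coalgebra.comul (R := k) x) := by
  induction x using homogeneous_induction h𝒜.isInternal with
  | hmem m y hy =>
    have hc : Coalgebra.comul (R := k) y ∈ tensFil 𝒜 m := by
      have := h𝒜.comul_mem hy
      simpa only [range_map_subtype, tensFil] using this
    rw [tproj_of_mem_tensFil _ hc]
    split_ifs with hm
    · subst hm
      rw [gproj_of_mem _ hy]
    · rw [gproj_of_mem_ne _ hm hy, map_zero]
  | hadd y z hy hz => simp only [map_add, hy, hz]

/-- Because `1` has degree `0`, the maps `x ↦ x ⊗ 1` and `x ↦ 1 ⊗ x` preserve degrees as `Δ` does.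
Hence homogeneous components of primitive elements are primitive. -/
theorem redComul_gproj (h𝒜 : IsGradedHopfAlgebra 𝒜) (n : ℕ) (x : H) :
    redComul k H (gproj h𝒜.isInternal n x) = tproj h𝒜.isInternal n (redComul k H x) := by
  rw [redComul_apply, redComul_apply, comul_gproj h𝒜, map_sub, map_sub]
  congr 1
  · congr 1
    induction x using homogeneous_induction h𝒜.isInternal with
    | hmem m y hy =>
      rw [tproj_tmul_of_mem _ hy h𝒜.one_mem, add_zero]
      split_ifs with hm
      · subst hm
        rw [gproj_of_mem _ hy]
      · rw [gproj_of_mem_ne _ hm hy, TensorProduct.zero_tmul]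
    | hadd y z hy hz => simp only [map_add, TensorProduct.add_tmul, hy, hz]
  · induction x using homogeneous_induction h𝒜.isInternal with
    | hmem m y hy =>
      rw [tproj_tmul_of_mem _ h𝒜.one_mem hy, zero_add]
      split_ifs with hm
      · subst hm
        rw [gproj_of_mem _ hy]
      · rw [gproj_of_mem_ne _ hm hy, TensorProduct.tmul_zero]
    | hadd y z hy hz => simp only [map_add, TensorProduct.tmul_add, hy, hz]

theorem mem_primitiveSpace_iff {x : H} : x ∈ primitiveSpace k H ↔ redComul k H x = 0 := by
  rw [redComul_apply, sub_sub, sub_eq_zero]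
  rfl

theorem gproj_mem_primitiveSpace (h𝒜 : IsGradedHopfAlgebra 𝒜) (n : ℕ) {x : H}
    (hx : x ∈ primitiveSpace k H) : gproj h𝒜.isInternal n x ∈ primitiveSpace k H := by
  rw [mem_primitiveSpace_iff] at hx ⊢
  rw [redComul_gproj h𝒜, hx, map_zero]

/-- Connectedness identifies the projection to degree zero with the counit; the counit axioms then
compute the extreme components of `Δ(x)` in the two lemmas that follow. -/
theorem gproj_zero_eq (h𝒜 : IsConnectedGradedHopfAlgebra 𝒜) (x : H) :
    gproj h𝒜.isInternal 0 x = algebraMap k H (Coalgebra.counit (R := k) x) := by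
  induction x using homogeneous_induction h𝒜.isInternal with
  | hmem n y hy =>
    by_cases hn : n = 0
    · subst hn
      rw [gproj_of_mem _ hy]
      rw [h𝒜.connected] at hy
      obtain ⟨c, rfl⟩ := Submodule.mem_span_singleton.1 hy
      rw [map_smul, Bialgebra.counit_one, smul_eq_mul, mul_one, Algebra.algebraMap_eq_smul_one]
    · rw [gproj_of_mem_ne _ hn hy, h𝒜.counit_eq_zero hn hy, map_zero]
  | hadd y z hy hz => simp only [map_add, hy, hz]

theorem map_gproj_zero_left (h𝒜 : IsConnectedGradedHopfAlgebra 𝒜) (n : ℕ) {x : H} (hx : x ∈ 𝒜 n) :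
    TensorProduct.map (gproj h𝒜.isInternal 0) (gproj h𝒜.isInternal n)
      (Coalgebra.comul (R := k) x) = 1 ⊗ₜ x := by
  have : gproj h𝒜.isInternal 0 = Algebra.linearMap k H ∘ₗ Coalgebra.counit (R := k) :=
    LinearMap.ext fun y => gproj_zero_eq h𝒜 y
  rw [this]
  have h2 : TensorProduct.map (Algebra.linearMap k H ∘ₗ Coalgebra.counit (R := k) (A := H))
      (gproj h𝒜.isInternal n) =
      TensorProduct.map (Algebra.linearMap k H) (gproj h𝒜.isInternal n) ∘ₗ
        LinearMap.rTensor H (Coalgebra.counit (R := k) (A := H)) := by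
    rw [LinearMap.rTensor, ← TensorProduct.map_comp, LinearMap.comp_id]
  rw [h2, LinearMap.comp_apply, Coalgebra.rTensor_counit_comul, TensorProduct.map_tmul,
    gproj_of_mem _ hx]
  simp

theorem map_gproj_zero_right (h𝒜 : IsConnectedGradedHopfAlgebra 𝒜) (n : ℕ) {x : H} (hx : x ∈ 𝒜 n) :
    TensorProduct.map (gproj h𝒜.isInternal n) (gproj h𝒜.isInternal 0)
      (Coalgebra.comul (R := k) x) = x ⊗ₜ 1 := by
  have : gproj h𝒜.isInternal 0 = Algebra.linearMap k H ∘ₗ Coalgebra.counit (R := k) :=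
    LinearMap.ext fun y => gproj_zero_eq h𝒜 y
  rw [this]
  have h2 : TensorProduct.map (gproj h𝒜.isInternal n)
      (Algebra.linearMap k H ∘ₗ Coalgebra.counit (R := k) (A := H)) =
      TensorProduct.map (gproj h𝒜.isInternal n) (Algebra.linearMap k H) ∘ₗ
        LinearMap.lTensor H (Coalgebra.counit (R := k) (A := H)) := by
    rw [LinearMap.lTensor, ← TensorProduct.map_comp, LinearMap.comp_id]
  rw [h2, LinearMap.comp_apply, Coalgebra.lTensor_counit_comul, TensorProduct.map_tmul,
    gproj_of_mem _ hx]
  simp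

/-- The tensors of homogeneous elements of `A` with degrees strictly between `0` and `p`. -/
def midTensors (𝒜 : ℕ → Submodule k H) (A : Subalgebra k H) (p : ℕ) : Set (H ⊗[k] H) :=
  {t | ∃ i j : ℕ, 0 < i ∧ i < p ∧ 0 < j ∧ j < p ∧ ∃ u v : H, u ∈ A ∧ u ∈ 𝒜 i ∧ v ∈ A ∧ v ∈ 𝒜 j ∧
    t = u ⊗ₜ v}

/-- The components of `Δ(a)` in bidegrees `(p, 0)` and `(0, p)` are exactly `a ⊗ 1` and `1 ⊗ a`.
Subtracting them leaves bidegrees with both entries strictly between `0` and `p`, which is what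
makes inductions on degree possible. -/
theorem redComul_mem_span_midTensors (h𝒜 : IsConnectedGradedHopfAlgebra 𝒜) {A : Subalgebra k H}
    (hA : IsHomog h𝒜.isInternal (Subalgebra.toSubmodule A)) {p : ℕ} (hp : 0 < p) {a : H}
    (ha : a ∈ 𝒜 p) (hΔ : Coalgebra.comul (R := k) a ∈
      tens (Subalgebra.toSubmodule A) (Subalgebra.toSubmodule A)) :
    redComul k H a ∈ Submodule.span k (midTensors 𝒜 A p) := by
  let f : ℕ × ℕ → H ⊗[k] H := fun q => TensorProduct.map (gproj h𝒜.isInternal q.1)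
    (gproj h𝒜.isInternal q.2) (Coalgebra.comul (R := k) a)
  have h1 : Coalgebra.comul (R := k) a = ∑ q ∈ Finset.HasAntidiagonal.antidiagonal p, f q := by
    have := comul_gproj h𝒜.toIsGradedHopfAlgebra p a
    rw [gproj_of_mem _ ha, tproj, LinearMap.sum_apply] at this
    exact this
  have h2 : redComul k H a =
      ∑ q ∈ ((Finset.HasAntidiagonal.antidiagonal p).erase (p, 0)).erase (0, p), f q := by
    have e1 := Finset.add_sum_erase (Finset.HasAntidiagonal.antidiagonal p) f (a := (p, 0)) (by simp)
    have e2 := Finset.add_sum_erase ((Finset.HasAntidiagonal.antidiagonal p).erase (p, 0)) f (a := (0, p))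
      (by simp; omega)
    rw [redComul_apply, h1, ← e1, ← e2]
    have e3 : f (p, 0) = a ⊗ₜ 1 := map_gproj_zero_right h𝒜 p ha
    have e4 : f (0, p) = 1 ⊗ₜ a := map_gproj_zero_left h𝒜 p ha
    rw [e3, e4]
    abel
  rw [h2]
  refine sum_mem ?_
  rintro ⟨i, j⟩ hij
  simp only [Finset.mem_erase, Finset.HasAntidiagonal.mem_antidiagonal, ne_eq, Prod.mk.injEq] at hij
  suffices hle : tens (Subalgebra.toSubmodule A) (Subalgebra.toSubmodule A) ≤
      (Submodule.span k (midTensors 𝒜 A p)).comap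
        (TensorProduct.map (gproj h𝒜.isInternal i) (gproj h𝒜.isInternal j)) from hle hΔ
  rw [tens_le]
  intro x hx y hy
  refine Submodule.subset_span ⟨i, j, by omega, by omega, by omega, by omega, _, _,
    hA i x hx, gproj_mem _ i x, hA j y hy, gproj_mem _ j y, rfl⟩

end GradedHopf

/-! ### Adjoining a relatively primitive element. -/

section Adjunction

variable {k H : Type*} [Field k] [Ring H] [HopfAlgebra k H] {𝒜 : ℕ → Submodule k H}

/-- The subalgebra generated by `A` and `z`. -/
noncomputable def adjoinElt (A : Subalgebra k H) (z : H) : Subalgebra k H :=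
  A ⊔ Algebra.adjoin k {z}

theorem le_adjoinElt (A : Subalgebra k H) (z : H) : A ≤ adjoinElt A z := le_sup_left

theorem self_mem_adjoinElt (A : Subalgebra k H) (z : H) : z ∈ adjoinElt A z :=
  (le_sup_right : Algebra.adjoin k {z} ≤ adjoinElt A z) (Algebra.subset_adjoin rfl)

theorem adjoinElt_le {A C : Subalgebra k H} {z : H} (hA : A ≤ C) (hz : z ∈ C) :
    adjoinElt A z ≤ C :=
  sup_le hA (Algebra.adjoin_le (by simpa using hz))

theorem mul_antipode_mem {A : Subalgebra k H} (hA : IsHopfSub A) {t : H ⊗[k] H}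
    (ht : t ∈ tens (Subalgebra.toSubmodule A) (Subalgebra.toSubmodule A)) :
    LinearMap.mul' k H ((HopfAlgebra.antipode k).rTensor H t) ∈ A := by
  suffices hle : tens (Subalgebra.toSubmodule A) (Subalgebra.toSubmodule A) ≤
      (Subalgebra.toSubmodule A).comap (LinearMap.mul' k H ∘ₗ (HopfAlgebra.antipode k).rTensor H)
    from hle ht
  rw [tens_le]
  intro x hx y hy
  exact A.mul_mem (hA.antipode_mem x hx) hy

/-- The antipode axiom at `z` reads `S(z) + z + ∑ S(w₁) w₂ = ε(z)` with `∑ w₁ ⊗ w₂ ∈ A ⊗ A`, and can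
be solved for `S(z)`. -/
theorem antipode_mem_adjoinElt {A : Subalgebra k H} (hA : IsHopfSub A) {z : H}
    (hz : z ∈ relPrim A) : HopfAlgebra.antipode k z ∈ adjoinElt A z := by
  have h1 := HopfAlgebra.mul_antipode_rTensor_comul_apply (R := k) z
  rw [comul_eq_add_redComul, map_add, map_add, map_add, map_add] at h1
  simp only [LinearMap.rTensor_tmul, LinearMap.mul'_apply, mul_one, HopfAlgebra.antipode_one,
    one_mul] at h1
  have h2 : HopfAlgebra.antipode k z = algebraMap k H (Coalgebra.counit (R := k) z) -
      LinearMap.mul' k H ((HopfAlgebra.antipode k).rTensor H (redComul k H z)) - z := by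
    rw [← h1]; abel
  rw [h2]
  exact sub_mem (sub_mem (Subalgebra.algebraMap_mem _ _)
    (le_adjoinElt A z (mul_antipode_mem hA hz))) (self_mem_adjoinElt A z)

/-- The elements whose coproduct lies in `B ⊗ B`, and those whose antipode lies in `B`, form
subalgebras, so both conditions need checking only on `A` and on `z`. -/
theorem IsHopfSub.adjoinElt {A : Subalgebra k H} (hA : IsHopfSub A) {z : H}
    (hz : z ∈ relPrim A) : IsHopfSub (adjoinElt A z) := by
  set B := _root_.adjoinElt A z with hB
  have hAB : Subalgebra.toSubmodule A ≤ Subalgebra.toSubmodule B := le_adjoinElt A z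
  have hzB : z ∈ B := self_mem_adjoinElt A z
  let T : Subalgebra k (H ⊗[k] H) :=
    (tens (Subalgebra.toSubmodule B) (Subalgebra.toSubmodule B)).toSubalgebra (one_mem_tens B)
      fun _ _ hs ht => mul_mem_tens B hs ht
  let C : Subalgebra k H :=
    { carrier := {x | HopfAlgebra.antipode k x ∈ B}
      mul_mem' := fun {x y} hx hy => by
        change HopfAlgebra.antipode k (x * y) ∈ B
        rw [HopfAlgebra.antipode_mul_antidistrib]
        exact B.mul_mem hy hx
      add_mem' := fun {x y} hx hy => by
        change HopfAlgebra.antipode k (x + y) ∈ B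
        rw [map_add]
        exact B.add_mem hx hy
      algebraMap_mem' := fun r => by
        change HopfAlgebra.antipode k (algebraMap k H r) ∈ B
        rw [Algebra.algebraMap_eq_smul_one, map_smul, HopfAlgebra.antipode_one]
        exact B.smul_mem B.one_mem r }
  constructor
  · have : B ≤ T.comap (Bialgebra.comulAlgHom k H) := by
      refine adjoinElt_le (fun a ha => tens_mono hAB hAB (hA.comul_mem a ha)) ?_
      change Coalgebra.comul (R := k) z ∈ tens _ _
      rw [comul_eq_add_redComul]
      exact add_mem (add_mem (tmul_mem_tens hzB B.one_mem) (tmul_mem_tens B.one_mem hzB))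
        (tens_mono hAB hAB hz)
    exact fun a ha => this ha
  · have : B ≤ C := adjoinElt_le (fun a ha => hAB (hA.antipode_mem a ha))
      (antipode_mem_adjoinElt hA hz)
    exact fun a ha => this ha

theorem gproj_mul_mem (h𝒜 : IsGradedHopfAlgebra 𝒜) (B : Subalgebra k H) {x y : H}
    (hx : ∀ n, gproj h𝒜.isInternal n x ∈ B) (hy : ∀ n, gproj h𝒜.isInternal n y ∈ B) (n : ℕ) :
    gproj h𝒜.isInternal n (x * y) ∈ B := by
  obtain ⟨N, hN⟩ := exists_eq_sum_gproj h𝒜.isInternal x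
  obtain ⟨M, hM⟩ := exists_eq_sum_gproj h𝒜.isInternal y
  rw [← hN N le_rfl, ← hM M le_rfl, Finset.sum_mul_sum, map_sum]
  refine sum_mem fun i _ => ?_
  rw [map_sum]
  refine sum_mem fun j _ => ?_
  have hm := h𝒜.mul_mem (gproj_mem h𝒜.isInternal i x) (gproj_mem h𝒜.isInternal j y)
  by_cases hij : i + j = n
  · subst hij
    rw [gproj_of_mem _ hm]
    exact B.mul_mem (hx i) (hy j)
  · rw [gproj_of_mem_ne _ hij hm]
    exact zero_mem _

theorem IsHomog.adjoinElt (h𝒜 : IsGradedHopfAlgebra 𝒜) {A : Subalgebra k H}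
    (hA : IsHomog h𝒜.isInternal (Subalgebra.toSubmodule A)) {z : H} {m : ℕ} (hz : z ∈ 𝒜 m) :
    IsHomog h𝒜.isInternal (Subalgebra.toSubmodule (adjoinElt A z)) := by
  let C : Subalgebra k H :=
    { carrier := {x | ∀ n, gproj h𝒜.isInternal n x ∈ _root_.adjoinElt A z}
      mul_mem' := fun {x y} hx hy => gproj_mul_mem h𝒜 _ hx hy
      add_mem' := fun {x y} hx hy n => by
        rw [map_add]
        exact add_mem (hx n) (hy n)
      algebraMap_mem' := fun r n => le_adjoinElt A z (hA n _ (A.algebraMap_mem r)) }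
  have : _root_.adjoinElt A z ≤ C := by
    refine adjoinElt_le (fun a ha n => le_adjoinElt A z (hA n a ha)) fun n => ?_
    by_cases hmn : m = n
    · subst hmn
      rw [gproj_of_mem _ hz]
      exact self_mem_adjoinElt A z
    · rw [gproj_of_mem_ne _ hmn hz]
      exact zero_mem _
  exact fun n x hx => this hx n

theorem isGradedHopfSubalgebra (h𝒜 : IsGradedHopfAlgebra 𝒜) {A : Subalgebra k H}
    (hA : IsHopfSub A) (hA' : IsHomog h𝒜.isInternal (Subalgebra.toSubmodule A)) :
    IsGradedHopfSubalgebra 𝒜 A where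
  comul_mem b hb := by
    rw [range_map_val]
    exact hA.comul_mem b hb
  antipode_mem := hA.antipode_mem
  homogeneous := le_iSup_inf_of_isHomog _ hA'

end Adjunction

/-! ### Lower bound for the Gelfand–Kirillov dimension. -/

section Growth

variable {k H : Type*} [Field k] [Ring H] [Algebra k H]

/-- The powers of `z` are left linearly independent over `A`. -/
def FreePowers (A : Subalgebra k H) (z : H) : Prop :=
  ∀ (n : ℕ) (b : ℕ → A), ∑ i ∈ Finset.range n, (b i : H) * z ^ i = 0 → ∀ i < n, b i = 0

/-- The algebra `A` contains a finite-dimensional subspace whose powers grow at least like a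
polynomial of degree `N`. -/
def HasGrowth (A : Subalgebra k H) (N : ℕ) : Prop :=
  ∃ V : Submodule k H, V.FG ∧ 1 ∈ V ∧ V ≤ Subalgebra.toSubmodule A ∧
    ∀ n : ℕ, (n + 1) ^ N ≤ Module.finrank k (V ^ (N * n) : Submodule k H)

theorem pow_le_toSubmodule {A : Subalgebra k H} {V : Submodule k H}
    (hV : V ≤ Subalgebra.toSubmodule A) (n : ℕ) : V ^ n ≤ Subalgebra.toSubmodule A := by
  induction n with
  | zero => rw [pow_zero, Submodule.one_le]; exact A.one_mem
  | succ n ih =>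
    rw [pow_succ, ← (Subalgebra.isIdempotentElem_toSubmodule A).eq]
    exact mul_le_mul' ih hV

theorem hasGrowth_bot [Nontrivial H] : HasGrowth (⊥ : Subalgebra k H) 0 := by
  refine ⟨1, ?_, Submodule.one_le.1 le_rfl, Submodule.one_le.2 (Subalgebra.one_mem _), fun n => ?_⟩
  · rw [Submodule.one_eq_span]
    exact Submodule.fg_span_singleton 1
  · rw [pow_zero, zero_mul, pow_zero, Submodule.one_eq_span, finrank_span_singleton one_ne_zero]

/-- With `V' = V + k z`, the power `V' ^ ((N + 1) * n)` contains `∑ V ^ (N * n) zⁱ` over `0 ≤ i ≤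
n`. The sum is direct by freeness, so the dimension gains a factor `n + 1`. -/
theorem HasGrowth.step {A B : Subalgebra k H} {N : ℕ} {z : H} (hA : HasGrowth A N)
    (hz : FreePowers A z) (hAB : A ≤ B) (hzB : z ∈ B) : HasGrowth B (N + 1) := by
  obtain ⟨V, hV, h1, hVA, hgr⟩ := hA
  refine ⟨V ⊔ Submodule.span k {z}, hV.sup (Submodule.fg_span_singleton z),
    Submodule.mem_sup_left h1, sup_le (hVA.trans hAB) (by
      rw [Submodule.span_singleton_le_iff_mem]; exact hzB), fun n => ?_⟩
  set V' := V ⊔ Submodule.span k {z} with hV'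
  have hV'fg : V'.FG := hV.sup (Submodule.fg_span_singleton z)
  have h1V' : (1 : Submodule k H) ≤ V' := Submodule.one_le.2 (Submodule.mem_sup_left h1)
  have hzV' : z ∈ V' := Submodule.mem_sup_right (Submodule.mem_span_singleton_self z)
  let W : Submodule k H := V ^ (N * n)
  have hWA : W ≤ Subalgebra.toSubmodule A := pow_le_toSubmodule hVA _
  let f : (Fin (n + 1) → W) →ₗ[k] H :=
    ∑ i : Fin (n + 1), LinearMap.mulRight k (z ^ (i : ℕ)) ∘ₗ W.subtype ∘ₗ LinearMap.proj i
  have hf : ∀ p, f p = ∑ i : Fin (n + 1), (p i : H) * z ^ (i : ℕ) := by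
    intro p
    simp [f]
  have hinj : Function.Injective f := by
    rw [injective_iff_map_eq_zero]
    intro p hp
    rw [hf] at hp
    -- Freeness is phrased for sequences indexed by `ℕ`; the coefficients are extended by zero.
    have := hz (n + 1) (fun i => if hi : i < n + 1 then ⟨p ⟨i, hi⟩, hWA (p ⟨i, hi⟩).2⟩ else 0) (by
      rw [Finset.sum_range, ← hp]
      refine Finset.sum_congr rfl fun i _ => ?_
      rw [dif_pos i.2])
    funext i
    have hi := this i i.2
    rw [dif_pos i.2] at hi
    exact Subtype.ext (congrArg (fun a : A => (a : H)) hi)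
  have hle : LinearMap.range f ≤ V' ^ ((N + 1) * n) := by
    rintro _ ⟨p, rfl⟩
    rw [hf]
    refine sum_mem fun i _ => ?_
    have hmem : (p i : H) * z ^ (i : ℕ) ∈ V' ^ (N * n + i) := by
      rw [pow_add]
      exact Submodule.mul_mem_mul ((pow_le_pow_left' le_sup_left _ : V ^ (N * n) ≤ V' ^ (N * n)) (p i).2)
        (Submodule.pow_mem_pow _ hzV' _)
    have hin : N * n + i ≤ (N + 1) * n := by
      have := i.2
      rw [add_mul]
      omega
    exact pow_le_pow_right' h1V' hin hmem
  have hfin : Module.Finite k (V' ^ ((N + 1) * n) : Submodule k H) :=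
    Module.Finite.iff_fg.2 (hV'fg.pow _)
  have hfinW : Module.Finite k W := Module.Finite.iff_fg.2 (hV.pow _)
  calc (n + 1) ^ (N + 1) = (n + 1) * (n + 1) ^ N := pow_succ' _ _
    _ ≤ (n + 1) * Module.finrank k W := Nat.mul_le_mul_left _ (hgr n)
    _ = Module.finrank k (Fin (n + 1) → W) := by
      rw [Module.finrank_pi_fintype]
      simp
    _ = Module.finrank k (LinearMap.range f) := (LinearMap.finrank_range_of_inj hinj).symm
    _ ≤ _ := Submodule.finrank_mono hle

/-- The dimension of `k + V + ⋯ + Vⁿ` is at least `(n / N) ^ N`, up to rounding, so the quotient of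
logarithms is at least `N - N log N / log n`, which tends to `N`. -/
theorem HasGrowth.le_gkDim {A : Subalgebra k H} {N : ℕ} (hA : HasGrowth A N) :
    (N : EReal) ≤ gkDim k H := by
  obtain ⟨V, hV, -, -, hgr⟩ := hA
  refine le_trans ?_ (le_iSup _ ⟨V, Module.Finite.iff_fg.2 hV⟩)
  have hlim : Filter.Tendsto (fun n : ℕ => (((N : ℝ) - N * Real.log N / Real.log n : ℝ) : EReal))
      Filter.atTop (nhds (N : EReal)) := by
    have h1 : Filter.Tendsto (fun n : ℕ => (N : ℝ) - N * Real.log N / Real.log n) Filter.atTop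
        (nhds ((N : ℝ) - 0)) :=
      tendsto_const_nhds.sub (tendsto_const_nhds.div_atTop
        (Real.tendsto_log_atTop.comp tendsto_natCast_atTop_atTop))
    rw [sub_zero] at h1
    exact (continuous_coe_real_ereal.tendsto _).comp h1
  rw [← hlim.limsup_eq]
  refine Filter.limsup_le_limsup ?_
  filter_upwards [Filter.eventually_ge_atTop 2] with n hn
  rw [EReal.coe_le_coe_iff]
  have hn1 : (1 : ℝ) < n := by exact_mod_cast hn
  have hlog : 0 < Real.log n := Real.log_pos hn1
  rw [le_div_iff₀ hlog, sub_mul, div_mul_cancel₀ _ hlog.ne', ← mul_sub]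
  set X : Submodule k H := ⨆ i ∈ Finset.range (n + 1), V ^ i with hX
  have hXfg : Module.Finite k X := by
    rw [Module.Finite.iff_fg]
    exact Submodule.fg_biSup _ _ fun i _ => hV.pow i
  -- Growth is known only for exponents divisible by `N`; the exponent `N * (n / N) ≤ n` with
  -- natural division is one of those in the sum.
  have hle : (n / N + 1) ^ N ≤ Module.finrank k X := by
    refine (hgr (n / N)).trans (Submodule.finrank_mono ?_)
    refine le_iSup₂_of_le (N * (n / N)) ?_ le_rfl
    rw [Finset.mem_range]
    exact Nat.lt_succ_of_le (Nat.mul_div_le n N)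
  have hle' : ((n / N : ℕ) + 1 : ℝ) ^ N ≤ Module.finrank k X := by exact_mod_cast hle
  have hlog2 := Real.log_le_log (by positivity) hle'
  rw [Real.log_pow] at hlog2
  refine le_trans ?_ hlog2
  rcases Nat.eq_zero_or_pos N with rfl | hN
  · simp
  · refine mul_le_mul_of_nonneg_left ?_ (Nat.cast_nonneg _)
    have hN' : (0 : ℝ) < N := by exact_mod_cast hN
    rw [← Real.log_div (by positivity) hN'.ne']
    refine Real.log_le_log (by positivity) ?_
    rw [div_le_iff₀ hN']
    have := Nat.lt_div_mul_add hN (a := n)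
    have h2 : n ≤ (n / N + 1) * N := by rw [add_mul]; omega
    exact_mod_cast h2

end Growth

/-! ### Upper bound for the Gelfand–Kirillov dimension. -/

section UpperBound

variable {k H : Type*} [Field k] [Ring H] [Algebra k H]

/-- The span of the homogeneous elements of degree at most `n`. -/
noncomputable def degLE (𝒜 : ℕ → Submodule k H) (n : ℕ) : Submodule k H :=
  ⨆ (i : ℕ) (_ : i ≤ n), 𝒜 i

variable {𝒜 : ℕ → Submodule k H}

theorem le_degLE {i n : ℕ} (hi : i ≤ n) : 𝒜 i ≤ degLE 𝒜 n := le_iSup₂_of_le i hi le_rfl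

theorem degLE_mono {m n : ℕ} (hmn : m ≤ n) : degLE 𝒜 m ≤ degLE 𝒜 n :=
  iSup₂_le fun _ hi => le_degLE (hi.trans hmn)

theorem degLE_mul_le (hmul : ∀ ⦃i j : ℕ⦄ ⦃a b : H⦄, a ∈ 𝒜 i → b ∈ 𝒜 j → a * b ∈ 𝒜 (i + j))
    (m n : ℕ) : degLE 𝒜 m * degLE 𝒜 n ≤ degLE 𝒜 (m + n) := by
  conv_lhs => unfold degLE
  simp only [Submodule.iSup_mul, Submodule.mul_iSup, iSup_le_iff]
  intro i hi j hj
  refine le_trans ?_ (le_degLE (i := j + i) (by omega))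
  rw [Submodule.mul_le]
  intro a ha b hb
  exact hmul ha hb

theorem sum_gproj_of_mem_degLE (h : DirectSum.IsInternal 𝒜) {n : ℕ} {x : H}
    (hx : x ∈ degLE 𝒜 n) : ∑ i ∈ Finset.range (n + 1), gproj h i x = x := by
  suffices hle : degLE 𝒜 n ≤
      LinearMap.ker (∑ i ∈ Finset.range (n + 1), gproj h i - LinearMap.id) by
    have := hle hx
    rw [LinearMap.mem_ker, LinearMap.sub_apply, sub_eq_zero, LinearMap.sum_apply] at this
    exact this
  refine iSup₂_le fun i hi y hy => ?_
  rw [LinearMap.mem_ker, LinearMap.sub_apply, sub_eq_zero, LinearMap.sum_apply,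
    Finset.sum_eq_single i]
  · exact gproj_of_mem h hy
  · intro j _ hj
    exact gproj_of_mem_ne h hj.symm hy
  · intro hc
    rw [Finset.mem_range] at hc
    omega

theorem exists_mem_degLE (h : DirectSum.IsInternal 𝒜) (x : H) : ∃ n, x ∈ degLE 𝒜 n := by
  obtain ⟨N, hN⟩ := exists_eq_sum_gproj h x
  refine ⟨N, ?_⟩
  rw [← hN N le_rfl]
  exact sum_mem fun i hi => le_degLE (Finset.mem_range.1 hi).le (gproj_mem h i x)

theorem exists_le_degLE (h : DirectSum.IsInternal 𝒜) {V : Submodule k H} (hV : V.FG) :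
    ∃ n, V ≤ degLE 𝒜 n := by
  induction V, hV using Submodule.fg_induction with
  | singleton x =>
    obtain ⟨n, hn⟩ := exists_mem_degLE h x
    exact ⟨n, (Submodule.span_singleton_le_iff_mem _ _).2 hn⟩
  | sup V W _ _ hV hW =>
    obtain ⟨m, hm⟩ := hV
    obtain ⟨n, hn⟩ := hW
    exact ⟨max m n, sup_le (hm.trans (degLE_mono (le_max_left _ _)))
      (hn.trans (degLE_mono (le_max_right _ _)))⟩

/-- The part of degree at most `n` of `A` has dimension at most `(n + 1) ^ N`. -/
def DimBound (𝒜 : ℕ → Submodule k H) (A : Subalgebra k H) (N : ℕ) : Prop :=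
  ∀ n : ℕ, ∃ S : Finset H, S.card ≤ (n + 1) ^ N ∧
    Subalgebra.toSubmodule A ⊓ degLE 𝒜 n ≤ Submodule.span k (S : Set H)

theorem dimBound_bot : DimBound 𝒜 (⊥ : Subalgebra k H) 0 := by
  refine fun n => ⟨{1}, by simp, inf_le_left.trans ?_⟩
  rw [Algebra.toSubmodule_bot, Submodule.one_eq_span]
  simp

/-- As `z ^ j` has degree `j * m ≥ j`, only `j ≤ n` contributes in degrees at most `n`, and the
coefficients have degree at most `n` too. The products `s * z ^ j` with `s` in a spanning set of
that part of `A` therefore suffice. -/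
theorem DimBound.step (h : DirectSum.IsInternal 𝒜)
    (hmul : ∀ ⦃i j : ℕ⦄ ⦃a b : H⦄, a ∈ 𝒜 i → b ∈ 𝒜 j → a * b ∈ 𝒜 (i + j)) (h1 : 1 ∈ 𝒜 0)
    {A B : Subalgebra k H} {N m : ℕ} {z : H}
    (hA : DimBound 𝒜 A N) (hAh : IsHomog h (Subalgebra.toSubmodule A)) (hz : z ∈ 𝒜 m) (hm : 0 < m)
    (hB : ∀ y ∈ B, ∃ (M : ℕ) (b : ℕ → A), y = ∑ j ∈ Finset.range M, (b j : H) * z ^ j) :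
    DimBound 𝒜 B (N + 1) := by
  classical
  intro n
  obtain ⟨S, hS, hle⟩ := hA n
  refine ⟨(S ×ˢ Finset.range (n + 1)).image fun p => p.1 * z ^ p.2, ?_, ?_⟩
  · refine Finset.card_image_le.trans ?_
    rw [Finset.card_product, Finset.card_range, pow_succ]
    exact Nat.mul_le_mul_right _ hS
  set T := Submodule.span k
    (((S ×ˢ Finset.range (n + 1)).image fun p => p.1 * z ^ p.2 : Finset H) : Set H) with hT
  have hpow : ∀ j, z ^ j ∈ 𝒜 (j * m) := by
    intro j
    induction j with
    | zero => simpa using h1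
    | succ j ih =>
      rw [pow_succ, add_mul, one_mul]
      exact hmul ih hz
  have hmulz : ∀ j ≤ n, ∀ c ∈ Subalgebra.toSubmodule A ⊓ degLE 𝒜 n, c * z ^ j ∈ T := by
    intro j hj c hc
    suffices hs : Submodule.span k (S : Set H) ≤ T.comap (LinearMap.mulRight k (z ^ j)) from
      hs (hle hc)
    rw [Submodule.span_le]
    intro s hs
    refine Submodule.subset_span ?_
    rw [Finset.mem_coe, Finset.mem_image]
    exact ⟨(s, j), Finset.mem_product.2 ⟨hs, Finset.mem_range.2 (by simpa [Nat.lt_succ_iff] using hj)⟩,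
      rfl⟩
  have key : ∀ i ≤ n, ∀ j, ∀ b ∈ A, gproj h i (b * z ^ j) ∈ T := by
    intro i hi j b hb
    obtain ⟨L, hL⟩ := exists_eq_sum_gproj h b
    rw [← hL L le_rfl, Finset.sum_mul, map_sum]
    refine sum_mem fun l _ => ?_
    have hmem := hmul (gproj_mem h l b) (hpow j)
    by_cases hl : l + j * m = i
    · rw [← hl, gproj_of_mem h hmem]
      have hj : j ≤ j * m := Nat.le_mul_of_pos_right j hm
      exact hmulz j (by omega) _ ⟨hAh l b hb, le_degLE (by omega) (gproj_mem h l b)⟩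
    · rw [gproj_of_mem_ne h hl hmem]
      exact zero_mem _
  rintro y ⟨hyB, hy⟩
  rw [← sum_gproj_of_mem_degLE h hy]
  obtain ⟨M, b, hb⟩ := hB y hyB
  refine sum_mem fun i hi => ?_
  rw [hb, map_sum]
  exact sum_mem fun j _ => key i (by rw [Finset.mem_range] at hi; omega) j _ (b j).2

/-- A finite-dimensional `V` lies in degrees at most some `m`, so `k + V + ⋯ + Vⁿ` lies in degrees
at most `m * n`. The factor between `m * n + 1` and `n` is bounded and disappears in the limit. -/
theorem DimBound.gkDim_le (h : DirectSum.IsInternal 𝒜)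
    (hmul : ∀ ⦃i j : ℕ⦄ ⦃a b : H⦄, a ∈ 𝒜 i → b ∈ 𝒜 j → a * b ∈ 𝒜 (i + j)) (h1 : 1 ∈ 𝒜 0) {N : ℕ}
    (hN : DimBound 𝒜 (⊤ : Subalgebra k H) N) : gkDim k H ≤ N := by
  refine iSup_le ?_
  rintro ⟨V, hV⟩
  obtain ⟨m, hm⟩ := exists_le_degLE h (Module.Finite.iff_fg.1 hV)
  have hlim : Filter.Tendsto
      (fun n : ℕ => (((N : ℝ) + N * Real.log (m + 1) / Real.log n : ℝ) : EReal))
      Filter.atTop (nhds (N : EReal)) := by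
    have h1 : Filter.Tendsto (fun n : ℕ => (N : ℝ) + N * Real.log (m + 1) / Real.log n) Filter.atTop
        (nhds ((N : ℝ) + 0)) :=
      tendsto_const_nhds.add (tendsto_const_nhds.div_atTop
        (Real.tendsto_log_atTop.comp tendsto_natCast_atTop_atTop))
    rw [add_zero] at h1
    exact (continuous_coe_real_ereal.tendsto _).comp h1
  rw [← hlim.limsup_eq]
  refine Filter.limsup_le_limsup ?_
  filter_upwards [Filter.eventually_ge_atTop 2] with n hn
  rw [EReal.coe_le_coe_iff]
  have hn1 : (1 : ℝ) < n := by exact_mod_cast hn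
  have hlog : 0 < Real.log n := Real.log_pos hn1
  rw [div_le_iff₀ hlog, add_mul, div_mul_cancel₀ _ hlog.ne', ← mul_add]
  set X : Submodule k H := ⨆ i ∈ Finset.range (n + 1), V ^ i with hX
  have hpow : ∀ i, V ^ i ≤ degLE 𝒜 (m * i) := by
    intro i
    induction i with
    | zero =>
      rw [pow_zero, Submodule.one_le]
      exact le_degLE (Nat.zero_le _) h1
    | succ i ih =>
      rw [pow_succ]
      exact (mul_le_mul' ih hm).trans (degLE_mul_le hmul _ _)
  have hXle : X ≤ degLE 𝒜 (m * n) := by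
    refine iSup₂_le fun i hi => (hpow i).trans (degLE_mono ?_)
    rw [Finset.mem_range] at hi
    exact Nat.mul_le_mul_left m (by omega)
  obtain ⟨S, hS, hle⟩ := hN (m * n)
  have hfr : Module.finrank k X ≤ (m * n + 1) ^ N := by
    have hfin : Module.Finite k (Submodule.span k (S : Set H)) :=
      Module.Finite.iff_fg.2 ⟨S, rfl⟩
    refine (Submodule.finrank_mono (hXle.trans (le_trans ?_ hle))).trans
      ((finrank_span_finset_le_card S).trans hS)
    exact le_inf (by simp) le_rfl
  have hfr' : (Module.finrank k X : ℝ) ≤ (((m + 1 : ℝ) * n) ^ N) := by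
    refine le_trans (b := (((m * n + 1) ^ N : ℕ) : ℝ)) (by exact_mod_cast hfr) ?_
    push_cast
    refine pow_le_pow_left₀ (by positivity) ?_ N
    nlinarith
  have hrhs : (N : ℝ) * (Real.log (m + 1) + Real.log n) = Real.log (((m + 1 : ℝ) * n) ^ N) := by
    rw [Real.log_pow, Real.log_mul (by positivity) (by positivity)]
  rw [add_comm]
  -- Monotonicity of the logarithm needs a positive argument; dimension zero is covered by the
  -- convention `Real.log 0 = 0`.
  rcases Nat.eq_zero_or_pos (Module.finrank k X) with h0 | h0
  · rw [h0]
    simp only [Nat.cast_zero, Real.log_zero]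
    have : 0 ≤ Real.log ((m : ℝ) + 1) := Real.log_nonneg (by linarith [Nat.cast_nonneg (α := ℝ) m])
    exact mul_nonneg (Nat.cast_nonneg _) (add_nonneg this hlog.le)
  · have := Real.log_le_log (by exact_mod_cast h0) hfr'
    linarith

end UpperBound

/-! ### Polynomials in `z` with left coefficients in `A`. -/

section OreSpanning

variable {k R : Type*} [Field k] [Ring R] [Algebra k R] (A : Subalgebra k R) (z : R)

/-- The map `∑ bᵢ tⁱ ↦ ∑ bᵢ zⁱ`. -/
noncomputable def polyMap : (ℕ →₀ A) →ₗ[k] R :=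
  Finsupp.lsum k fun j => LinearMap.mulRight k (z ^ j) ∘ₗ A.val.toLinearMap

theorem polyMap_apply (p : ℕ →₀ A) : polyMap A z p = p.sum fun i b => (b : R) * z ^ i := rfl

theorem polyMap_single (j : ℕ) (a : A) : polyMap A z (Finsupp.single j a) = a * z ^ j := by
  rw [polyMap_apply, Finsupp.sum_single_index]
  simp

theorem exists_polyMap_eq_sum_range (p : ℕ →₀ A) : ∃ M, (∀ i, M ≤ i → p i = 0) ∧
    polyMap A z p = ∑ i ∈ Finset.range M, (p i : R) * z ^ i := by
  obtain ⟨M, hM⟩ := p.support.exists_nat_subset_range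
  refine ⟨M, fun i hi => ?_, ?_⟩
  · by_contra hne
    have := hM (Finsupp.mem_support_iff.2 hne)
    rw [Finset.mem_range] at this
    omega
  · rw [polyMap_apply]
    exact Finsupp.sum_of_support_subset p hM _ (by simp)

variable {A z}

theorem FreePowers.polyMap_injective (h : FreePowers A z) : Function.Injective (polyMap A z) := by
  rw [injective_iff_map_eq_zero]
  intro p hp
  obtain ⟨M, hM, hsum⟩ := exists_polyMap_eq_sum_range A z p
  rw [hsum] at hp
  ext1 i
  rcases lt_or_ge i M with hi | hi
  · exact h M p hp i hi
  · exact hM i hi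

/-- If `z` normalizes `A`, then `∑ A zⁱ` is the algebra generated by `A` and `z`. -/
theorem adjoin_le_range_polyMap (hz : ∀ a ∈ A, z * a - a * z ∈ A) {y : R}
    (hy : y ∈ A ⊔ Algebra.adjoin k {z}) : y ∈ LinearMap.range (polyMap A z) := by
  let T := LinearMap.range (polyMap A z)
  have hT : ∀ a ∈ A, ∀ j, a * z ^ j ∈ T := fun a ha j =>
    ⟨Finsupp.single j ⟨a, ha⟩, polyMap_single A z j ⟨a, ha⟩⟩
  have hind : ∀ x : R, (∀ a ∈ A, ∀ j, x * (a * z ^ j) ∈ T) → ∀ t ∈ T, x * t ∈ T := by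
    rintro x hx _ ⟨p, rfl⟩
    rw [polyMap_apply, Finsupp.sum, Finset.mul_sum]
    exact sum_mem fun i _ => hx _ (p i).2 i
  -- The left multipliers of `T` form a subalgebra. It contains `A` and `z`, and `1 ∈ T`, so the
  -- algebra they generate is contained in `T`.
  let C : Subalgebra k R :=
    { carrier := {x | ∀ t ∈ T, x * t ∈ T}
      mul_mem' := fun {x y} hx hy t ht => by
        rw [mul_assoc]
        exact hx _ (hy t ht)
      add_mem' := fun {x y} hx hy t ht => by
        rw [add_mul]
        exact add_mem (hx t ht) (hy t ht)
      algebraMap_mem' := fun r t ht => by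
        rw [← Algebra.smul_def]
        exact T.smul_mem r ht }
  have hC : A ⊔ Algebra.adjoin k {z} ≤ C := by
    refine sup_le ?_ (Algebra.adjoin_le ?_)
    · intro x hx
      refine hind x fun a ha j => ?_
      rw [← mul_assoc]
      exact hT _ (A.mul_mem hx ha) j
    · intro x hx
      obtain rfl : x = z := hx
      refine hind _ fun a ha j => ?_
      have : x * (a * x ^ j) = a * x ^ (j + 1) + (x * a - a * x) * x ^ j := by
        rw [pow_succ']; noncomm_ring
      rw [this]
      exact add_mem (hT a ha _) (hT _ (hz a ha) j)
  have h1 : (1 : R) ∈ T := by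
    have := hT 1 A.one_mem 0
    simpa using this
  have := hC hy 1 h1
  rwa [mul_one] at this

end OreSpanning

/-! ### Towers of graded Hopf subalgebras and their length. -/

section Towers

variable {k H : Type*} [Field k] [Ring H] [HopfAlgebra k H] {𝒜 : ℕ → Submodule k H}

/-- A Hopf subalgebra spanned by homogeneous elements. -/
structure IsGradedSub (h : DirectSum.IsInternal 𝒜) (A : Subalgebra k H) : Prop where
  hopf : IsHopfSub A
  homog : IsHomog h (Subalgebra.toSubmodule A)

theorem IsGradedSub.adjoinElt (h𝒜 : IsGradedHopfAlgebra 𝒜) {A : Subalgebra k H}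
    (hA : IsGradedSub h𝒜.isInternal A) {z : H} {m : ℕ} (hzm : z ∈ 𝒜 m) (hz : z ∈ relPrim A) :
    IsGradedSub h𝒜.isInternal (adjoinElt A z) :=
  ⟨hA.hopf.adjoinElt hz, IsHomog.adjoinElt h𝒜 hA.homog hzm⟩

theorem isGradedSub_bot (h𝒜 : IsGradedHopfAlgebra 𝒜) : IsGradedSub h𝒜.isInternal ⊥ := by
  refine ⟨⟨?_, ?_⟩, ?_⟩
  · intro a ha
    obtain ⟨c, rfl⟩ := Algebra.mem_bot.1 ha
    rw [Bialgebra.comul_algebraMap, Algebra.algebraMap_eq_smul_one]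
    exact Submodule.smul_mem _ _ (one_mem_tens _)
  · intro a ha
    obtain ⟨c, rfl⟩ := Algebra.mem_bot.1 ha
    rw [Algebra.algebraMap_eq_smul_one, map_smul, HopfAlgebra.antipode_one]
    exact Subalgebra.smul_mem _ (Subalgebra.one_mem _) c
  · rw [Algebra.toSubmodule_bot, Submodule.one_eq_span]
    exact isHomog_span_singleton _ h𝒜.one_mem

theorem relPrim_mono {A B : Subalgebra k H} (hAB : A ≤ B) : relPrim A ≤ relPrim B :=
  Submodule.comap_mono (tens_mono hAB hAB)

theorem freePowers [CharZero k] {A : Subalgebra k H} (hA : IsHopfSub A) {z : H}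
    (hz : z ∈ relPrim A) (hzA : z ∉ A) : FreePowers A z :=
  eq_zero_of_sum_mul_pow_eq_zero hA hz hzA

/-- `A` is obtained from `k` by adjoining `N` homogeneous elements, each primitive modulo the
previous subalgebra. -/
inductive Tower (𝒜 : ℕ → Submodule k H) : ℕ → Subalgebra k H → Prop
  | base : Tower 𝒜 0 ⊥
  | step {N m : ℕ} {A : Subalgebra k H} {z : H} : Tower 𝒜 N A → z ∈ 𝒜 m → z ∈ relPrim A → z ∉ A →
      Tower 𝒜 (N + 1) (adjoinElt A z)

theorem Tower.isGradedSub (h𝒜 : IsGradedHopfAlgebra 𝒜) {N : ℕ} {A : Subalgebra k H}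
    (hA : Tower 𝒜 N A) : IsGradedSub h𝒜.isInternal A := by
  induction hA with
  | base => exact isGradedSub_bot h𝒜
  | step _ hm hz _ ih => exact ih.adjoinElt h𝒜 hm hz

theorem Tower.hasGrowth [CharZero k] (h𝒜 : IsGradedHopfAlgebra 𝒜) {N : ℕ} {A : Subalgebra k H}
    (hA : Tower 𝒜 N A) : HasGrowth A N := by
  induction hA with
  | base =>
    have := Bialgebra.nontrivial k (A := H)
    exact hasGrowth_bot
  | step hT hm hz hzA ih =>
    exact ih.step (freePowers (hT.isGradedSub h𝒜).hopf hz hzA) (le_adjoinElt _ _)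
      (self_mem_adjoinElt _ _)

theorem Tower.le_of_gkDim [CharZero k] (h𝒜 : IsGradedHopfAlgebra 𝒜) {d : ℝ}
    (hd : gkDim k H = (d : EReal)) {N : ℕ} {A : Subalgebra k H} (hA : Tower 𝒜 N A) :
    (N : ℝ) ≤ d := by
  have := (hA.hasGrowth h𝒜).le_gkDim
  rw [hd] at this
  exact_mod_cast this

/-! ### Degrees of relatively primitive elements are bounded. -/

/-- The span of the homogeneous elements of degree greater than `m`. -/
noncomputable def degGT (𝒜 : ℕ → Submodule k H) (m : ℕ) : Submodule k H :=
  ⨆ (i : ℕ) (_ : m < i), 𝒜 i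

theorem le_degGT {m i : ℕ} (hi : m < i) : 𝒜 i ≤ degGT 𝒜 m := le_iSup₂_of_le i hi le_rfl

theorem degGT_anti {m n : ℕ} (hmn : m ≤ n) : degGT 𝒜 n ≤ degGT 𝒜 m :=
  iSup₂_le fun _ hi => le_degGT (hmn.trans_lt hi)

theorem gproj_of_mem_degGT (h : DirectSum.IsInternal 𝒜) {m n : ℕ} (hmn : n ≤ m) {x : H}
    (hx : x ∈ degGT 𝒜 m) : gproj h n x = 0 := by
  suffices hle : degGT 𝒜 m ≤ LinearMap.ker (gproj h n) from hle hx
  exact iSup₂_le fun i hi y hy => gproj_of_mem_ne h (by omega) hy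

theorem mem_of_mem_sup_degGT (h : DirectSum.IsInternal 𝒜) {S : Submodule k H} (hS : IsHomog h S)
    {m : ℕ} {x : H} (hx : x ∈ 𝒜 m) (hx' : x ∈ S ⊔ degGT 𝒜 m) : x ∈ S := by
  obtain ⟨s, hs, r, hr, hsr⟩ := Submodule.mem_sup.1 hx'
  have := congrArg (gproj h m) hsr
  rw [map_add, gproj_of_mem_degGT h le_rfl hr, add_zero, gproj_of_mem h hx] at this
  rw [← this]
  exact hS m s hs

theorem mul_mem_degGT (h𝒜 : IsGradedHopfAlgebra 𝒜) {m : ℕ} {x y : H} (hx : x ∈ degGT 𝒜 m) :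
    x * y ∈ degGT 𝒜 m ∧ y * x ∈ degGT 𝒜 m := by
  induction y using homogeneous_induction h𝒜.isInternal with
  | hmem n y hy =>
    constructor
    · suffices hle : degGT 𝒜 m ≤ (degGT 𝒜 m).comap (LinearMap.mulRight k y) from hle hx
      exact iSup₂_le fun i hi x hx => le_degGT (by omega) (h𝒜.mul_mem hx hy)
    · suffices hle : degGT 𝒜 m ≤ (degGT 𝒜 m).comap (LinearMap.mulLeft k y) from hle hx
      exact iSup₂_le fun i hi x hx => le_degGT (by omega) (h𝒜.mul_mem hy hx)
  | hadd y z hy hz =>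
    rw [mul_add, add_mul]
    exact ⟨add_mem hy.1 hz.1, add_mem hy.2 hz.2⟩

/-- The subalgebra of the elements congruent to elements of `A` modulo degrees greater than `m`. -/
noncomputable def supDegGT (h𝒜 : IsGradedHopfAlgebra 𝒜) (A : Subalgebra k H) (m : ℕ) :
    Subalgebra k H :=
  (Subalgebra.toSubmodule A ⊔ degGT 𝒜 m).toSubalgebra (Submodule.mem_sup_left A.one_mem) (by
    intro x y hx hy
    obtain ⟨a, ha, r, hr, rfl⟩ := Submodule.mem_sup.1 hx
    obtain ⟨b, hb, s, hs, rfl⟩ := Submodule.mem_sup.1 hy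
    rw [add_mul, mul_add, add_assoc]
    exact add_mem (Submodule.mem_sup_left (A.mul_mem ha hb)) (Submodule.mem_sup_right
      (add_mem (mul_mem_degGT h𝒜 hs).2 (mul_mem_degGT h𝒜 hr).1)))

/-- Elements are adjoined with the higher degrees first. What was adjoined before `z` changes `A`
only in degrees above that of `z`, so `z` is still outside the enlarged algebra, while relative
primitivity persists under enlargement. -/
theorem exists_long_tower (h𝒜 : IsGradedHopfAlgebra 𝒜) {N : ℕ} {A : Subalgebra k H}
    (hA : Tower 𝒜 N A) (hinf : ∀ m₀, ∃ m, m₀ < m ∧ ∃ z ∈ 𝒜 m, z ∈ relPrim A ∧ z ∉ A) (r m₀ : ℕ) :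
    ∃ B, Tower 𝒜 (N + r) B ∧ A ≤ B ∧ B ≤ supDegGT h𝒜 A m₀ := by
  induction r generalizing m₀ with
  | zero => exact ⟨A, hA, le_rfl, fun a ha => Submodule.mem_sup_left ha⟩
  | succ r ih =>
    obtain ⟨m, hm, z, hzm, hz, hzA⟩ := hinf m₀
    -- The bound is raised from `m₀` to the degree `m` of `z`, so that `B` agrees with `A` in degree
    -- `m`.
    obtain ⟨B, hB, hAB, hBle⟩ := ih m
    have hzB : z ∉ B := fun hzB => hzA
      (mem_of_mem_sup_degGT h𝒜.isInternal (hA.isGradedSub h𝒜).homog hzm (hBle hzB))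
    refine ⟨adjoinElt B z, hB.step hzm (relPrim_mono hAB hz) hzB,
      hAB.trans (le_adjoinElt B z), adjoinElt_le (fun b hb => ?_) ?_⟩
    · exact sup_le_sup le_rfl (degGT_anti hm.le) (hBle hb)
    · exact Submodule.mem_sup_right (le_degGT hm hzm)

theorem exists_degree_bound [CharZero k] (h𝒜 : IsGradedHopfAlgebra 𝒜) {d : ℝ}
    (hd : gkDim k H = (d : EReal)) {N : ℕ} {A : Subalgebra k H} (hA : Tower 𝒜 N A) :
    ∃ m₀, ∀ m, m₀ < m → ∀ z ∈ 𝒜 m, z ∈ relPrim A → z ∈ A := by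
  by_contra! hc
  obtain ⟨r, hr⟩ := exists_nat_gt d
  obtain ⟨B, hB, -, -⟩ := exists_long_tower h𝒜 hA hc r 0
  have := hB.le_of_gkDim h𝒜 hd
  push_cast at this
  linarith [Nat.cast_nonneg (α := ℝ) N]

theorem exists_maximal_of_bound {p : ℕ → Prop} {n₀ b : ℕ} (hn₀ : p n₀) (hb : ∀ n, b < n → ¬ p n) :
    ∃ n, p n ∧ ∀ n', n < n' → ¬ p n' := by
  classical
  have hle : n₀ ≤ b := by
    by_contra! hc
    exact hb n₀ hc hn₀
  refine ⟨Nat.findGreatest p b, Nat.findGreatest_spec hle hn₀, fun n' hn' => ?_⟩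
  rcases le_or_gt n' b with h | h
  · exact Nat.findGreatest_is_greatest hn' h
  · exact hb n' h

/-! ### Normal steps. -/

/-- `z` is homogeneous of degree `m`, primitive modulo `A ⊗ A`, not in `A`, and normalizes `A`. -/
structure IsNormalStep (𝒜 : ℕ → Submodule k H) (A : Subalgebra k H) (z : H) (m : ℕ) : Prop where
  mem : z ∈ 𝒜 m
  relPrim : z ∈ relPrim A
  notMem : z ∉ A
  comm : ∀ a ∈ A, z * a - a * z ∈ A

theorem mem_tens_top (t : H ⊗[k] H) :
    t ∈ tens (Subalgebra.toSubmodule (⊤ : Subalgebra k H)) (Subalgebra.toSubmodule (⊤ : Subalgebra k H)) := by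
  induction t with
  | zero => exact zero_mem _
  | add a b ha hb => exact add_mem ha hb
  | tmul a b => exact tmul_mem_tens (Algebra.mem_top (R := k)) (Algebra.mem_top (R := k))

theorem mem_of_mem_zero (h𝒜 : IsConnectedGradedHopfAlgebra 𝒜) (A : Subalgebra k H) {x : H}
    (hx : x ∈ 𝒜 0) : x ∈ A := by
  rw [h𝒜.connected] at hx
  obtain ⟨c, rfl⟩ := Submodule.mem_span_singleton.1 hx
  exact A.smul_mem A.one_mem c

/-- A homogeneous element of least degree outside `A` works: the middle part of its coproduct
involves only strictly smaller degrees, where everything is in `A`. -/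
theorem exists_relPrim_notMem (h𝒜 : IsConnectedGradedHopfAlgebra 𝒜) {A : Subalgebra k H}
    (hA : A ≠ ⊤) : ∃ m, ∃ z ∈ 𝒜 m, z ∈ relPrim A ∧ z ∉ A := by
  classical
  have hex : ∃ n, ∃ x ∈ 𝒜 n, x ∉ A := by
    by_contra! hc
    apply hA
    rw [eq_top_iff]
    intro x _
    exact mem_of_forall_gproj_mem h𝒜.isInternal (S := Subalgebra.toSubmodule A)
      fun n => hc n _ (gproj_mem h𝒜.isInternal n x)
  obtain ⟨z, hz, hzA⟩ := Nat.find_spec hex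
  refine ⟨_, z, hz, ?_, hzA⟩
  have hlow : ∀ i, i < Nat.find hex → ∀ x ∈ 𝒜 i, x ∈ A := by
    intro i hi x hx
    by_contra hc
    exact Nat.find_min hex hi ⟨x, hx, hc⟩
  have hpos : 0 < Nat.find hex := by
    rw [Nat.pos_iff_ne_zero]
    intro h0
    rw [h0] at hz
    exact hzA (mem_of_mem_zero h𝒜 A hz)
  have hmid := redComul_mem_span_midTensors h𝒜 (A := ⊤) (fun _ _ _ => Algebra.mem_top (R := k)) hpos hz
    (mem_tens_top _)
  refine (Submodule.span_le.2 ?_ : Submodule.span k (midTensors 𝒜 ⊤ (Nat.find hex)) ≤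
    tens (Subalgebra.toSubmodule A) (Subalgebra.toSubmodule A)) hmid
  rintro _ ⟨i, j, -, hi, -, hj, u, v, -, hu, -, hv, rfl⟩
  exact tmul_mem_tens (hlow i hi u hu) (hlow j hj v hv)

/-- With `Δz = X + w` and `Δa = a ⊗ 1 + 1 ⊗ a + t`, the reduced coproduct of `[z, a]` is `[X, t] +
[w, Δa]`. The second term lies in `A ⊗ A`. In the first, `[X, ·]` acts on tensors as a derivation,
and `t` involves only degrees below `p`, where commutators with `z` are already known to lie in `A`.
-/
theorem commutator_mem_relPrim {A : Subalgebra k H} (hA : IsHopfSub A) {z a : H}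
    (hz : z ∈ relPrim A) (ha : a ∈ A) {p : ℕ}
    (hmid : redComul k H a ∈ Submodule.span k (midTensors 𝒜 A p))
    (hlow : ∀ i < p, ∀ b ∈ A, b ∈ 𝒜 i → z * b - b * z ∈ A) :
    z * a - a * z ∈ relPrim A := by
  set t := redComul k H a with ht
  set w := redComul k H z with hw
  set X : H ⊗[k] H := z ⊗ₜ 1 + 1 ⊗ₜ z with hX
  have h1 : redComul k H (z * a - a * z) =
      (X * t - t * X) + (w * Coalgebra.comul (R := k) a - Coalgebra.comul (R := k) a * w) := by
    have e : X * (a ⊗ₜ[k] (1 : H) + 1 ⊗ₜ a) - (a ⊗ₜ[k] (1 : H) + 1 ⊗ₜ a) * X =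
        (z * a - a * z) ⊗ₜ 1 + 1 ⊗ₜ (z * a - a * z) := by
      simp only [hX, add_mul, mul_add, Algebra.TensorProduct.tmul_mul_tmul, mul_one, one_mul,
        TensorProduct.sub_tmul, TensorProduct.tmul_sub]
      abel
    rw [redComul_apply, map_sub, Bialgebra.comul_mul, Bialgebra.comul_mul,
      comul_eq_add_redComul z, sub_sub, ← e, comul_eq_add_redComul a, ← ht, ← hw, ← hX]
    noncomm_ring
  rw [relPrim, Submodule.mem_comap, h1]
  have hc := hA.comul_mem a ha
  refine add_mem ?_ (sub_mem (mul_mem_tens A hz hc) (mul_mem_tens A hc hz))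
  suffices hle : Submodule.span k (midTensors 𝒜 A p) ≤
      (tens (Subalgebra.toSubmodule A) (Subalgebra.toSubmodule A)).comap
        (LinearMap.mulLeft k X - LinearMap.mulRight k X) from hle hmid
  rw [Submodule.span_le]
  rintro _ ⟨i, j, -, hi, -, hj, u, v, hu, hui, hv, hvj, rfl⟩
  have e : X * u ⊗ₜ v - u ⊗ₜ v * X = (z * u - u * z) ⊗ₜ v + u ⊗ₜ (z * v - v * z) := by
    simp only [hX, add_mul, mul_add, Algebra.TensorProduct.tmul_mul_tmul, mul_one, one_mul,
      TensorProduct.sub_tmul, TensorProduct.tmul_sub]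
    abel
  change X * u ⊗ₜ v - u ⊗ₜ v * X ∈ tens _ _
  rw [e]
  exact add_mem (tmul_mem_tens (hlow i hi u hu hui) hv) (tmul_mem_tens hu (hlow j hj v hv hvj))

/-- A proper graded Hopf subalgebra occurring in a tower has a normal step: an element of maximal
degree among the homogeneous elements outside `A` which are primitive modulo `A ⊗ A`. -/
theorem exists_isNormalStep [CharZero k] (h𝒜 : IsConnectedGradedHopfAlgebra 𝒜) {d : ℝ}
    (hd : gkDim k H = (d : EReal)) {N : ℕ} {A : Subalgebra k H} (hA : Tower 𝒜 N A) (hne : A ≠ ⊤) :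
    ∃ z m, IsNormalStep 𝒜 A z m := by
  have hG := hA.isGradedSub h𝒜.toIsGradedHopfAlgebra
  obtain ⟨m₀, hm₀⟩ := exists_degree_bound h𝒜.toIsGradedHopfAlgebra hd hA
  obtain ⟨n₀, hn₀⟩ := exists_relPrim_notMem h𝒜 hne
  obtain ⟨m, ⟨z, hzm, hz, hzA⟩, hmax⟩ := exists_maximal_of_bound
    (p := fun m => ∃ z ∈ 𝒜 m, z ∈ relPrim A ∧ z ∉ A) hn₀
    (fun n hn ⟨z, hzn, hz, hzA⟩ => hzA (hm₀ n hn z hzn hz))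
  refine ⟨z, m, hzm, hz, hzA, ?_⟩
  have key : ∀ p, ∀ a ∈ A, a ∈ 𝒜 p → z * a - a * z ∈ A := by
    intro p
    induction p using Nat.strong_induction_on with
    | _ p ih =>
      intro a ha hap
      rcases Nat.eq_zero_or_pos p with rfl | hp
      · rw [h𝒜.connected] at hap
        obtain ⟨c, rfl⟩ := Submodule.mem_span_singleton.1 hap
        simp
      · by_contra hc
        -- If the commutator were outside `A`, it would be a relatively primitive element of degree
        -- `m + p > m`, against the maximality of `m`.
        refine hmax (m + p) (by omega) ⟨_, ?_, commutator_mem_relPrim hG.hopf hz ha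
          (redComul_mem_span_midTensors h𝒜 hG.homog hp hap (hG.hopf.comul_mem a ha)) ih, hc⟩
        exact sub_mem (h𝒜.mul_mem hzm hap) (add_comm p m ▸ h𝒜.mul_mem hap hzm)
  have hle : Subalgebra.toSubmodule A ≤ (Subalgebra.toSubmodule A).comap
      (LinearMap.mulLeft k z - LinearMap.mulRight k z) :=
    (le_iSup_inf_of_isHomog _ hG.homog).trans (iSup_le fun n a ha => key n a ha.1 ha.2)
  exact fun a ha => hle ha

/-! ### Chains of normal steps and the count of their length. -/

/-- `B` is obtained from `A₀` by adjoining `n` elements by normal steps. -/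
inductive NormalExt (𝒜 : ℕ → Submodule k H) (A₀ : Subalgebra k H) : ℕ → Subalgebra k H → Prop
  | refl : NormalExt 𝒜 A₀ 0 A₀
  | step {n m : ℕ} {A : Subalgebra k H} {z : H} : NormalExt 𝒜 A₀ n A → IsNormalStep 𝒜 A z m →
      NormalExt 𝒜 A₀ (n + 1) (adjoinElt A z)

theorem NormalExt.isGradedSub (h𝒜 : IsGradedHopfAlgebra 𝒜) {A₀ B : Subalgebra k H} {n : ℕ}
    (h : NormalExt 𝒜 A₀ n B) (hA₀ : IsGradedSub h𝒜.isInternal A₀) :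
    IsGradedSub h𝒜.isInternal B := by
  induction h with
  | refl => exact hA₀
  | step _ hs ih => exact ih.adjoinElt h𝒜 hs.mem hs.relPrim

theorem NormalExt.tower {A₀ B : Subalgebra k H} {n N : ℕ} (h : NormalExt 𝒜 A₀ n B)
    (hA₀ : Tower 𝒜 N A₀) : Tower 𝒜 (N + n) B := by
  induction h with
  | refl => exact hA₀
  | step _ hs ih => exact ih.step hs.mem hs.relPrim hs.notMem

theorem NormalExt.trans {A₀ B C : Subalgebra k H} {m n : ℕ} (h : NormalExt 𝒜 A₀ m B)
    (h' : NormalExt 𝒜 B n C) : NormalExt 𝒜 A₀ (m + n) C := by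
  induction h' with
  | refl => exact h
  | step _ hs ih => exact ih.step hs

theorem IsNormalStep.exists_eq_sum {A : Subalgebra k H} {z : H} {m : ℕ}
    (hs : IsNormalStep 𝒜 A z m) {y : H} (hy : y ∈ _root_.adjoinElt A z) :
    ∃ (M : ℕ) (b : ℕ → A), y = ∑ j ∈ Finset.range M, (b j : H) * z ^ j := by
  obtain ⟨p, rfl⟩ := adjoin_le_range_polyMap hs.comm hy
  obtain ⟨M, -, hM⟩ := exists_polyMap_eq_sum_range A z p
  exact ⟨M, p, hM⟩

theorem IsNormalStep.pos (h𝒜 : IsConnectedGradedHopfAlgebra 𝒜) {A : Subalgebra k H} {z : H} {m : ℕ}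
    (hs : IsNormalStep 𝒜 A z m) : 0 < m := by
  rw [Nat.pos_iff_ne_zero]
  rintro rfl
  exact hs.notMem (mem_of_mem_zero h𝒜 A hs.mem)

theorem NormalExt.dimBound (h𝒜 : IsConnectedGradedHopfAlgebra 𝒜) {B : Subalgebra k H} {n : ℕ}
    (h : NormalExt 𝒜 ⊥ n B) : DimBound 𝒜 B n := by
  induction h with
  | refl => exact dimBound_bot
  | step h' hs ih =>
    exact ih.step h𝒜.isInternal h𝒜.mul_mem h𝒜.one_mem
      (h'.isGradedSub h𝒜.toIsGradedHopfAlgebra (isGradedSub_bot h𝒜.toIsGradedHopfAlgebra)).homog hs.mem (hs.pos h𝒜)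
      fun y hy => hs.exists_eq_sum hy

theorem IsNormalStep.isGradedOreExtension [CharZero k] (h𝒜 : IsGradedHopfAlgebra 𝒜)
    {A : Subalgebra k H} (hA : IsHopfSub A) {z : H} {m : ℕ} (hs : IsNormalStep 𝒜 A z m) :
    IsGradedOreExtensionOfDerivationType 𝒜 A (_root_.adjoinElt A z) := by
  let δ : A →ₗ[k] A :=
    { toFun := fun a => ⟨z * a - a * z, hs.comm a a.2⟩
      map_add' := fun a b => Subtype.ext (by
        change z * (a + b : H) - (a + b : H) * z = (z * a - a * z) + (z * b - b * z)
        noncomm_ring)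
      map_smul' := fun c a => Subtype.ext (by
        change z * (c • (a : H)) - (c • (a : H)) * z = c • (z * a - a * z)
        rw [mul_smul_comm, smul_mul_assoc, smul_sub]) }
  refine ⟨δ, z, m, ⟨le_adjoinElt A z, self_mem_adjoinElt A z, ?_, ?_, ?_⟩, hs.mem, ?_⟩
  · intro a b
    apply Subtype.ext
    change z * (a * b : H) - (a * b : H) * z = a * (z * b - b * z) + (z * a - a * z) * b
    noncomm_ring
  · intro b
    change z * b = b * z + (z * b - b * z)
    abel
  · intro c hc
    obtain ⟨p, rfl⟩ := adjoin_le_range_polyMap hs.comm hc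
    refine ⟨p, polyMap_apply A z p, fun q hq => ?_⟩
    apply (freePowers hA hs.relPrim hs.notMem).polyMap_injective
    rw [polyMap_apply A z q]
    exact hq.symm
  · intro n b hb
    exact sub_mem (add_comm m n ▸ h𝒜.mul_mem hs.mem hb) (h𝒜.mul_mem hb hs.mem)

theorem NormalExt.exists_chain [CharZero k] (h𝒜 : IsGradedHopfAlgebra 𝒜) {A₀ B : Subalgebra k H}
    {n : ℕ} (h : NormalExt 𝒜 A₀ n B) (hA₀ : IsGradedSub h𝒜.isInternal A₀) :
    ∃ C : Fin (n + 1) → Subalgebra k H, C 0 = A₀ ∧ C (Fin.last n) = B ∧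
      (∀ i, IsGradedHopfSubalgebra 𝒜 (C i)) ∧
      ∀ i : Fin n, IsGradedOreExtensionOfDerivationType 𝒜 (C i.castSucc) (C i.succ) := by
  induction h with
  | refl =>
    exact ⟨fun _ => A₀, rfl, rfl, fun _ => isGradedHopfSubalgebra h𝒜 hA₀.hopf hA₀.homog,
      fun i => i.elim0⟩
  | @step n m A z h' hs ih =>
    obtain ⟨C, h0, hl, hC, hO⟩ := ih
    have hA := h'.isGradedSub h𝒜 hA₀
    have hB := hA.adjoinElt h𝒜 hs.mem hs.relPrim
    refine ⟨Fin.snoc C (_root_.adjoinElt A z), ?_, by simp, fun i => ?_, fun i => ?_⟩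
    · rw [← h0]
      exact Fin.snoc_castSucc (α := fun _ => Subalgebra k H) (adjoinElt A z) C 0
    · refine Fin.lastCases ?_ (fun i => ?_) i
      · rw [Fin.snoc_last]
        exact isGradedHopfSubalgebra h𝒜 hB.hopf hB.homog
      · rw [Fin.snoc_castSucc]
        exact hC i
    · refine Fin.lastCases ?_ (fun i => ?_) i
      · rw [Fin.snoc_castSucc, Fin.succ_last, Fin.snoc_last, hl]
        exact hs.isGradedOreExtension h𝒜 hA.hopf
      · rw [Fin.snoc_castSucc, Fin.succ_castSucc, Fin.snoc_castSucc]
        exact hO i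

theorem exists_normalExt_top [CharZero k] (h𝒜 : IsConnectedGradedHopfAlgebra 𝒜) {d : ℝ}
    (hd : gkDim k H = (d : EReal)) {N : ℕ} {A : Subalgebra k H} (hA : Tower 𝒜 N A) :
    ∃ n, NormalExt 𝒜 A n ⊤ := by
  obtain ⟨b, hb⟩ := exists_nat_gt d
  obtain ⟨n, ⟨B, hB⟩, hmax⟩ := exists_maximal_of_bound (p := fun n => ∃ B, NormalExt 𝒜 A n B)
    ⟨A, NormalExt.refl⟩ (b := b) (by
      rintro n hn ⟨B, hB⟩
      have := (hB.tower hA).le_of_gkDim h𝒜.toIsGradedHopfAlgebra hd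
      push_cast at this
      have hn' : (b : ℝ) < n := by exact_mod_cast hn
      linarith [Nat.cast_nonneg (α := ℝ) N])
  by_cases hne : B = ⊤
  · exact ⟨n, hne ▸ hB⟩
  · obtain ⟨z, m, hs⟩ := exists_isNormalStep h𝒜 hd (hB.tower hA) hne
    exact absurd ⟨_, hB.step hs⟩ (hmax (n + 1) (Nat.lt_succ_self n))

/-- Freeness gives `N ≤ d` and the spanning property with positive degrees gives `d ≤ N`; in
particular `d` is an integer. -/
theorem NormalExt.eq_gkDim [CharZero k] (h𝒜 : IsConnectedGradedHopfAlgebra 𝒜) {d : ℝ}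
    (hd : gkDim k H = (d : EReal)) {N : ℕ} (hN : NormalExt 𝒜 ⊥ N (⊤ : Subalgebra k H)) :
    (N : ℝ) = d := by
  apply le_antisymm
  · have := (hN.tower Tower.base).le_of_gkDim h𝒜.toIsGradedHopfAlgebra hd
    simpa using this
  · have := (hN.dimBound h𝒜).gkDim_le h𝒜.isInternal h𝒜.mul_mem h𝒜.one_mem
    rw [hd] at this
    exact_mod_cast this

end Towers

/-! ### The primitive space and the embedding of its enveloping algebra. -/

section Primitive

variable {k H : Type*} [Field k] [Ring H] [HopfAlgebra k H] {𝒜 : ℕ → Submodule k H}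

theorem commutator_mem_adjoin {R : Type*} [Ring R] [Algebra k R] {s : Set R} {x : R}
    (h : ∀ a ∈ s, x * a - a * x ∈ Algebra.adjoin k s) {a : R} (ha : a ∈ Algebra.adjoin k s) :
    x * a - a * x ∈ Algebra.adjoin k s := by
  induction ha using Algebra.adjoin_induction with
  | mem a ha => exact h a ha
  | algebraMap r => rw [← Algebra.commutes, sub_self]; exact zero_mem _
  | add a b _ _ ha hb =>
    have : x * (a + b) - (a + b) * x = (x * a - a * x) + (x * b - b * x) := by noncomm_ring
    rw [this]
    exact add_mem ha hb
  | mul a b hA hB ha hb =>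
    have : x * (a * b) - a * b * x = (x * a - a * x) * b + a * (x * b - b * x) := by noncomm_ring
    rw [this]
    exact add_mem (mul_mem ha hB) (mul_mem hA hb)

theorem counit_eq_zero_of_mem_primitiveSpace {x : H} (hx : x ∈ primitiveSpace k H) :
    Coalgebra.counit (R := k) x = 0 := by
  have h1 : Coalgebra.comul (R := k) x = x ⊗ₜ[k] 1 + 1 ⊗ₜ[k] x := hx
  have h2 := Coalgebra.rTensor_counit_comul (R := k) x
  rw [h1, map_add, LinearMap.rTensor_tmul, LinearMap.rTensor_tmul, Bialgebra.counit_one,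
    add_eq_right] at h2
  have h3 := congrArg (fun t => Coalgebra.counit (R := k) (TensorProduct.lid k H t)) h2
  simpa using h3

theorem eq_zero_of_mem_primitiveSpace_zero (h𝒜 : IsConnectedGradedHopfAlgebra 𝒜) {x : H}
    (hx : x ∈ primitiveSpace k H) (hx0 : x ∈ 𝒜 0) : x = 0 := by
  have := gproj_zero_eq h𝒜 x
  rwa [gproj_of_mem _ hx0, counit_eq_zero_of_mem_primitiveSpace hx, map_zero] at this

theorem mem_relPrim_of_mem_primitiveSpace {x : H} (hx : x ∈ primitiveSpace k H)
    (A : Subalgebra k H) : x ∈ relPrim A := by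
  rw [relPrim, Submodule.mem_comap, mem_primitiveSpace_iff.1 hx]
  exact zero_mem _

theorem commutator_mem_primitiveSpace {x y : H} (hx : x ∈ primitiveSpace k H)
    (hy : y ∈ primitiveSpace k H) : x * y - y * x ∈ primitiveSpace k H := by
  rw [← LieRing.of_associative_ring_bracket]
  exact (primitiveSpace k H).lie_mem hx hy

theorem envPrimitiveMap_ι (x : primitiveSpace k H) :
    envPrimitiveMap k H (UniversalEnvelopingAlgebra.ι k x) = x :=
  UniversalEnvelopingAlgebra.lift_ι_apply k _ x

/-- The generators of the enveloping algebra coming from a subspace of the primitive space. -/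
def envGenerators (Q : Submodule k H) :
    Set (UniversalEnvelopingAlgebra k (primitiveSpace k H)) :=
  {u | ∃ x : primitiveSpace k H, (x : H) ∈ Q ∧ u = UniversalEnvelopingAlgebra.ι k x}

/-- An upper segment of the primitive space: it contains all primitive elements of degree greater
than `m + 1` and lies in degrees greater than `m`; its enveloping algebra embeds in `H` and the
image is reached from `k` by normal steps. -/
structure PrimitiveSegment (h : DirectSum.IsInternal 𝒜) (N : ℕ) (Q : Submodule k H) (m : ℕ) :
    Prop where
  le : Q ≤ (primitiveSpace k H).toSubmodule
  fg : Q.FG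
  finrank : Module.finrank k Q = N
  homog : IsHomog h Q
  le_deg : Q ≤ degGT 𝒜 m
  mem_of_lt : ∀ n, m + 1 < n → ∀ x ∈ 𝒜 n, x ∈ primitiveSpace k H → x ∈ Q
  normalExt : NormalExt 𝒜 ⊥ N (Algebra.adjoin k (Q : Set H))
  injective : ∀ u ∈ Algebra.adjoin k (envGenerators Q), envPrimitiveMap k H u = 0 → u = 0

theorem envPrimitiveMap_mem_adjoin {Q : Submodule k H}
    {u : UniversalEnvelopingAlgebra k (primitiveSpace k H)}
    (hu : u ∈ Algebra.adjoin k (envGenerators Q)) :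
    envPrimitiveMap k H u ∈ Algebra.adjoin k (Q : Set H) := by
  suffices h : Algebra.adjoin k (envGenerators Q) ≤
      (Algebra.adjoin k (Q : Set H)).comap (envPrimitiveMap k H) from h hu
  refine Algebra.adjoin_le ?_
  rintro _ ⟨x, hx, rfl⟩
  change envPrimitiveMap k H _ ∈ Algebra.adjoin k (Q : Set H)
  rw [envPrimitiveMap_ι]
  exact Algebra.subset_adjoin hx

/-- Start of the descent: primitive elements are relatively primitive over `k`, so in high degrees
they are scalars, and a primitive scalar vanishes by the counit. -/
theorem exists_primitiveSegment [CharZero k] (h𝒜 : IsConnectedGradedHopfAlgebra 𝒜) {d : ℝ}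
    (hd : gkDim k H = (d : EReal)) : ∃ m, PrimitiveSegment h𝒜.isInternal 0 (⊥ : Submodule k H) m := by
  obtain ⟨m, hm⟩ := exists_degree_bound h𝒜.toIsGradedHopfAlgebra hd Tower.base
  refine ⟨m, bot_le, Submodule.fg_bot, finrank_bot k H, ?_, bot_le, ?_, ?_, ?_⟩
  · intro n x hx
    rw [(Submodule.mem_bot k).1 hx, map_zero]
    exact zero_mem _
  · intro n hn x hxn hx
    have h1 := hm n (by omega) x hxn (mem_relPrim_of_mem_primitiveSpace hx _)
    obtain ⟨c, rfl⟩ := Algebra.mem_bot.1 h1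
    have h2 := counit_eq_zero_of_mem_primitiveSpace hx
    rw [Bialgebra.counit_algebraMap] at h2
    rw [h2, map_zero]
    exact zero_mem _
  · have : Algebra.adjoin k ((⊥ : Submodule k H) : Set H) = ⊥ := by
      rw [eq_bot_iff]
      refine Algebra.adjoin_le ?_
      intro x hx
      rw [(Submodule.mem_bot k).1 hx]
      exact zero_mem _
    rw [this]
    exact NormalExt.refl
  · intro u hu hu0
    have : Algebra.adjoin k (envGenerators (⊥ : Submodule k H)) ≤ ⊥ := by
      refine Algebra.adjoin_le ?_
      rintro _ ⟨x, hx, rfl⟩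
      have : x = 0 := Subtype.ext ((Submodule.mem_bot k).1 hx)
      rw [this, map_zero]
      exact zero_mem _
    obtain ⟨c, rfl⟩ := Algebra.mem_bot.1 (this hu)
    rw [AlgHom.commutes] at hu0
    have h0 := congrArg (Coalgebra.counit (R := k)) hu0
    rw [Bialgebra.counit_algebraMap, map_zero] at h0
    rw [h0, map_zero]

/-- Products of two elements of `Q` have degree greater than `m + 1`, so `k + Q` together with the
degrees above `m + 1` is a subalgebra. Its part of degree `m + 1` lies in `Q`. -/
theorem notMem_adjoin_of_le_degGT (h𝒜 : IsGradedHopfAlgebra 𝒜) {Q : Submodule k H}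
    (hQ : IsHomog h𝒜.isInternal Q) {m : ℕ} (hQm : Q ≤ degGT 𝒜 m) {z : H} (hz : z ∈ 𝒜 (m + 1))
    (hzQ : z ∉ Q) : z ∉ Algebra.adjoin k (Q : Set H) := by
  have hdeg : degGT 𝒜 m * degGT 𝒜 m ≤ degGT 𝒜 (m + 1) := by
    conv_lhs => unfold degGT
    simp only [Submodule.iSup_mul, Submodule.mul_iSup, iSup_le_iff]
    intro i hi j hj
    rw [Submodule.mul_le]
    intro a ha b hb
    exact le_degGT (by omega) (h𝒜.mul_mem ha hb)
  let C : Subalgebra k H :=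
    ((Submodule.span k {1} ⊔ Q) ⊔ degGT 𝒜 (m + 1)).toSubalgebra
      (Submodule.mem_sup_left (Submodule.mem_sup_left (Submodule.mem_span_singleton_self 1))) (by
        intro x y hx hy
        obtain ⟨x', hx', r, hr, rfl⟩ := Submodule.mem_sup.1 hx
        obtain ⟨y', hy', s, hs, rfl⟩ := Submodule.mem_sup.1 hy
        obtain ⟨c', hc', q, hq, rfl⟩ := Submodule.mem_sup.1 hx'
        obtain ⟨e', he', p, hp, rfl⟩ := Submodule.mem_sup.1 hy'
        obtain ⟨c, rfl⟩ := Submodule.mem_span_singleton.1 hc'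
        obtain ⟨e, rfl⟩ := Submodule.mem_span_singleton.1 he'
        have e1 : (c • (1 : H) + q + r) * (e • (1 : H) + p + s) =
            (((c * e) • (1 : H)) + (c • p + e • q)) +
              (q * p + (c • (1 : H) + q) * s + r * (e • (1 : H) + p + s)) := by
          simp only [add_mul, mul_add, smul_mul_assoc, mul_smul_comm, one_mul, mul_one, smul_smul,
            smul_add]
          rw [mul_comm e c]
          abel
        rw [e1]
        refine Submodule.add_mem_sup (Submodule.add_mem_sup ?_ ?_) (add_mem (add_mem ?_ ?_) ?_)
        · exact Submodule.smul_mem _ _ (Submodule.mem_span_singleton_self 1)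
        · exact add_mem (Q.smul_mem c hp) (Q.smul_mem e hq)
        · exact hdeg (Submodule.mul_mem_mul (hQm hq) (hQm hp))
        · exact (mul_mem_degGT h𝒜 hs).2
        · exact (mul_mem_degGT h𝒜 hr).1)
  have hC : Algebra.adjoin k (Q : Set H) ≤ C :=
    Algebra.adjoin_le fun q hq => Submodule.mem_sup_left (Submodule.mem_sup_right hq)
  intro hmem
  have h1 := mem_of_mem_sup_degGT h𝒜.isInternal
    ((isHomog_span_singleton _ h𝒜.one_mem).sup _ hQ) hz (hC hmem)
  obtain ⟨c, hc, q, hq, hcq⟩ := Submodule.mem_sup.1 h1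
  obtain ⟨c, rfl⟩ := Submodule.mem_span_singleton.1 hc
  have h2 := congrArg (gproj h𝒜.isInternal (m + 1)) hcq
  rw [map_add, map_smul, gproj_of_mem_ne _ (Nat.succ_ne_zero m).symm h𝒜.one_mem, smul_zero, zero_add,
    gproj_of_mem _ hz] at h2
  exact hzQ (h2 ▸ hQ _ q hq)

theorem finrank_sup_span_singleton_of_notMem {V : Type*} [AddCommGroup V] [Module k V]
    {Q : Submodule k V} (hQ : Q.FG) {z : V} (hz : z ∉ Q) :
    Module.finrank k (Q ⊔ Submodule.span k {z} : Submodule k V) = Module.finrank k Q + 1 := by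
  have : Module.Finite k Q := Module.Finite.iff_fg.2 hQ
  have hz0 : z ≠ 0 := by
    rintro rfl
    exact hz (zero_mem _)
  have h1 := Submodule.finrank_sup_add_finrank_inf_eq Q (Submodule.span k {z})
  have h2 : Q ⊓ Submodule.span k {z} = ⊥ := by
    rw [← disjoint_iff, Submodule.disjoint_span_singleton' hz0]
    exact hz
  rw [h2, finrank_bot, add_zero, finrank_span_singleton hz0] at h1
  exact h1

/-- A primitive `z` of maximal degree outside `Q` satisfies `[z, Q] ⊆ Q`, because nonzero
homogeneous primitives have positive degree and bracketing with them raises the degree. Hence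
adjoining `z` is a normal step, and the freeness of the powers of `z` carries injectivity from the
algebra generated by `Q` to the larger one. -/
theorem PrimitiveSegment.exists_step [CharZero k] (h𝒜 : IsConnectedGradedHopfAlgebra 𝒜) {N m : ℕ}
    {Q : Submodule k H} (hQ : PrimitiveSegment h𝒜.isInternal N Q m)
    (hne : ¬ (primitiveSpace k H).toSubmodule ≤ Q) :
    ∃ Q' m', PrimitiveSegment h𝒜.isInternal (N + 1) Q' m' := by
  obtain ⟨x, hxP, hxQ⟩ := SetLike.not_le_iff_exists.1 hne
  obtain ⟨n₀, hn₀⟩ := exists_gproj_notMem h𝒜.isInternal hxQ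
  obtain ⟨n, ⟨z, hzn, hzP, hzQ⟩, hmax⟩ := exists_maximal_of_bound
    (p := fun n => ∃ z ∈ 𝒜 n, z ∈ primitiveSpace k H ∧ z ∉ Q) (n₀ := n₀) (b := m + 1)
    ⟨_, gproj_mem _ n₀ x, gproj_mem_primitiveSpace h𝒜.toIsGradedHopfAlgebra n₀ hxP, hn₀⟩
    (fun n hn ⟨z, hzn, hzP, hzQ⟩ => hzQ (hQ.mem_of_lt n hn z hzn hzP))
  have hnm : n ≤ m + 1 := by
    by_contra! hc
    exact hzQ (hQ.mem_of_lt n hc z hzn hzP)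
  -- Only `m' ≤ m` is claimed. Equality is allowed, so that one degree can be exhausted by several
  -- steps.
  obtain ⟨m', rfl⟩ : ∃ m', n = m' + 1 := by
    refine Nat.exists_eq_succ_of_ne_zero ?_
    rintro rfl
    rw [eq_zero_of_mem_primitiveSpace_zero h𝒜 hzP hzn] at hzQ
    exact hzQ (zero_mem _)
  have hQm' : Q ≤ degGT 𝒜 m' := hQ.le_deg.trans (degGT_anti (by omega))
  have hcomm : ∀ a ∈ Q, z * a - a * z ∈ Q := by
    have hle : Q ≤ Q.comap (LinearMap.mulLeft k z - LinearMap.mulRight k z) := by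
      refine (le_iSup_inf_of_isHomog _ hQ.homog).trans (iSup_le fun i a ha => ?_)
      change z * a - a * z ∈ Q
      rcases Nat.eq_zero_or_pos i with rfl | hi
      · rw [eq_zero_of_mem_primitiveSpace_zero h𝒜 (hQ.le ha.1) ha.2, mul_zero, zero_mul, sub_zero]
        exact zero_mem _
      · by_contra hc
        exact hmax (m' + 1 + i) (by omega) ⟨_, sub_mem (h𝒜.mul_mem hzn ha.2)
          (add_comm i (m' + 1) ▸ h𝒜.mul_mem ha.2 hzn),
          commutator_mem_primitiveSpace hzP (hQ.le ha.1), hc⟩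
    exact fun a ha => hle ha
  have hzA : z ∉ Algebra.adjoin k (Q : Set H) :=
    notMem_adjoin_of_le_degGT h𝒜.toIsGradedHopfAlgebra hQ.homog hQm' hzn hzQ
  set A := Algebra.adjoin k (Q : Set H) with hA
  have hs : IsNormalStep 𝒜 A z (m' + 1) :=
    ⟨hzn, mem_relPrim_of_mem_primitiveSpace hzP _, hzA, fun a ha =>
      commutator_mem_adjoin (fun a ha => Algebra.subset_adjoin (hcomm a ha)) ha⟩
  have hAs := hQ.normalExt.isGradedSub h𝒜.toIsGradedHopfAlgebra
    (isGradedSub_bot h𝒜.toIsGradedHopfAlgebra)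
  have hadj : Algebra.adjoin k ((Q ⊔ Submodule.span k {z} : Submodule k H) : Set H) =
      adjoinElt A z := by
    apply le_antisymm
    · refine Algebra.adjoin_le ?_
      have : Q ⊔ Submodule.span k {z} ≤ Subalgebra.toSubmodule (adjoinElt A z) := by
        refine sup_le (fun q hq => le_adjoinElt A z (Algebra.subset_adjoin hq)) ?_
        rw [Submodule.span_singleton_le_iff_mem]
        exact self_mem_adjoinElt A z
      exact this
    · refine adjoinElt_le (Algebra.adjoin_mono fun q hq => Submodule.mem_sup_left hq)
        (Algebra.subset_adjoin (Submodule.mem_sup_right (Submodule.mem_span_singleton_self z)))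
  refine ⟨Q ⊔ Submodule.span k {z}, m', ?_, ?_, ?_, ?_, ?_, ?_, ?_, ?_⟩
  · exact sup_le hQ.le ((Submodule.span_singleton_le_iff_mem _ _).2 hzP)
  · exact hQ.fg.sup (Submodule.fg_span_singleton z)
  · rw [finrank_sup_span_singleton_of_notMem hQ.fg hzQ, hQ.finrank]
  · exact hQ.homog.sup _ (isHomog_span_singleton _ hzn)
  · exact sup_le hQm' ((Submodule.span_singleton_le_iff_mem _ _).2
      (le_degGT (Nat.lt_succ_self m') hzn))
  · intro i hi y hyi hy
    by_contra hc
    exact hmax i hi ⟨y, hyi, hy, fun hyQ => hc (Submodule.mem_sup_left hyQ)⟩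
  · rw [hadj]
    exact hQ.normalExt.step hs
  · set UQ := Algebra.adjoin k (envGenerators Q) with hUQ
    let ζ := UniversalEnvelopingAlgebra.ι k (⟨z, hzP⟩ : primitiveSpace k H)
    have hζ : ∀ u ∈ UQ, ζ * u - u * ζ ∈ UQ := by
      intro u hu
      refine commutator_mem_adjoin ?_ hu
      rintro _ ⟨a, ha, rfl⟩
      refine Algebra.subset_adjoin ⟨⁅(⟨z, hzP⟩ : primitiveSpace k H), a⁆, hcomm a ha, ?_⟩
      rw [LieHom.map_lie, LieRing.of_associative_ring_bracket]
    have hle : Algebra.adjoin k (envGenerators (Q ⊔ Submodule.span k {z})) ≤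
        UQ ⊔ Algebra.adjoin k {ζ} := by
      refine Algebra.adjoin_le ?_
      rintro _ ⟨y, hy, rfl⟩
      obtain ⟨q, hq, w, hw, hqw⟩ := Submodule.mem_sup.1 hy
      obtain ⟨c, rfl⟩ := Submodule.mem_span_singleton.1 hw
      have hy' : y = (⟨q, hQ.le hq⟩ : primitiveSpace k H) + c • ⟨z, hzP⟩ := Subtype.ext hqw.symm
      rw [hy', map_add, map_smul]
      refine add_mem ?_ (Subalgebra.smul_mem _ ?_ c)
      · exact (le_sup_left : UQ ≤ UQ ⊔ Algebra.adjoin k {ζ})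
          (Algebra.subset_adjoin ⟨⟨q, hQ.le hq⟩, hq, rfl⟩)
      · exact (le_sup_right : Algebra.adjoin k {ζ} ≤ UQ ⊔ Algebra.adjoin k {ζ})
          (Algebra.subset_adjoin rfl)
    intro u hu hu0
    obtain ⟨p, rfl⟩ := adjoin_le_range_polyMap hζ (hle hu)
    obtain ⟨M, hM, hsum⟩ := exists_polyMap_eq_sum_range UQ ζ p
    rw [hsum, map_sum] at hu0
    have hzero := freePowers hAs.hopf hs.relPrim hs.notMem M
      (fun i => ⟨envPrimitiveMap k H (p i), envPrimitiveMap_mem_adjoin (p i).2⟩) (by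
        rw [← hu0]
        refine Finset.sum_congr rfl fun i _ => ?_
        rw [map_mul, map_pow, envPrimitiveMap_ι])
    rw [hsum]
    refine Finset.sum_eq_zero fun i hi => ?_
    have h1 := congrArg (fun a : A => (a : H)) (hzero i (Finset.mem_range.1 hi))
    rw [hQ.injective (p i) (p i).2 h1, zero_mul]

/-- Segments have bounded size by the tower bound, and a maximal one exhausts `P(H)`. This yields
finite dimension, injectivity and the number of steps together. -/
theorem exists_normalExt_range [CharZero k] (h𝒜 : IsConnectedGradedHopfAlgebra 𝒜) {d : ℝ}
    (hd : gkDim k H = (d : EReal)) :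
    Module.Finite k (primitiveSpace k H) ∧ Function.Injective (envPrimitiveMap k H) ∧
      NormalExt 𝒜 ⊥ (Module.finrank k (primitiveSpace k H)) (envPrimitiveMap k H).range := by
  obtain ⟨b, hb⟩ := exists_nat_gt d
  obtain ⟨N, ⟨Q, m, hQ⟩, hmax⟩ := exists_maximal_of_bound
    (p := fun N => ∃ Q m, PrimitiveSegment h𝒜.isInternal N Q m) (b := b)
    ⟨⊥, exists_primitiveSegment h𝒜 hd⟩ (by
      rintro n hn ⟨Q, m, hQ⟩
      have := (hQ.normalExt.tower Tower.base).le_of_gkDim h𝒜.toIsGradedHopfAlgebra hd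
      push_cast at this
      have hn' : (b : ℝ) < n := by exact_mod_cast hn
      linarith)
  have hle : (primitiveSpace k H).toSubmodule ≤ Q := by
    by_contra hc
    exact hmax (N + 1) (Nat.lt_succ_self N) (hQ.exists_step h𝒜 hc)
  obtain rfl : Q = (primitiveSpace k H).toSubmodule := le_antisymm hQ.le hle
  have htop : Algebra.adjoin k (envGenerators (primitiveSpace k H).toSubmodule) = ⊤ := by
    rw [← EnvHopf.adjoin_ι]
    congr 1
    ext u
    constructor
    · rintro ⟨x, -, rfl⟩
      exact ⟨x, rfl⟩
    · rintro ⟨x, rfl⟩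
      exact ⟨x, x.2, rfl⟩
  have hrange : (envPrimitiveMap k H).range =
      Algebra.adjoin k ((primitiveSpace k H).toSubmodule : Set H) := by
    apply le_antisymm
    · rintro _ ⟨u, rfl⟩
      exact envPrimitiveMap_mem_adjoin (htop ▸ Algebra.mem_top)
    · exact Algebra.adjoin_le fun x hx => ⟨_, envPrimitiveMap_ι ⟨x, hx⟩⟩
  refine ⟨Module.Finite.iff_fg.2 hQ.fg, ?_, ?_⟩
  · rw [injective_iff_map_eq_zero]
    exact fun u hu => hQ.injective u (htop ▸ Algebra.mem_top) hu
  · have hfin : Module.finrank k (primitiveSpace k H) = N := hQ.finrank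
    rw [hrange, hfin]
    exact hQ.normalExt

end Primitive

/-! ### The grading of an enveloping algebra. -/

section Source

variable {k L : Type*} [Field k] [LieRing L] [LieAlgebra k L]

local notation "U" => UniversalEnvelopingAlgebra k L
local notation "ι" => UniversalEnvelopingAlgebra.ι k

theorem env_comul_ι (x : L) :
    Coalgebra.comul (R := k) (ι x : U) = ι x ⊗ₜ[k] 1 + 1 ⊗ₜ[k] ι x :=
  EnvHopf.comulHom_ι x

theorem env_counit_ι (x : L) : Coalgebra.counit (R := k) (ι x : U) = 0 :=
  EnvHopf.counitHom_ι x

theorem env_antipode_ι (x : L) : HopfAlgebra.antipode k (ι x : U) = -ι x :=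
  EnvHopf.antipodeLin_ι x

variable {ℒ : ℕ → Submodule k L}

theorem prod_mem_grading (l : List (ℕ × L)) (hl : ∀ p ∈ l, p.2 ∈ ℒ p.1) :
    (l.map fun p => (ι p.2 : U)).prod ∈ EnvHopf.grading ℒ (l.map Prod.fst).sum :=
  Submodule.subset_span ⟨l, hl, rfl, rfl⟩

theorem grading_le {W : ℕ → Submodule k U} (h : ∀ l : List (ℕ × L), (∀ p ∈ l, p.2 ∈ ℒ p.1) →
    (l.map fun p => (ι p.2 : U)).prod ∈ W (l.map Prod.fst).sum) (n : ℕ) :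
    EnvHopf.grading ℒ n ≤ W n := by
  refine Submodule.span_le.2 ?_
  rintro _ ⟨l, hl, rfl, rfl⟩
  exact h l hl

theorem one_mem_grading : (1 : U) ∈ EnvHopf.grading ℒ 0 := by
  simpa using prod_mem_grading (k := k) (ℒ := ℒ) [] (by simp)

theorem ι_mem_grading {n : ℕ} {x : L} (hx : x ∈ ℒ n) : (ι x : U) ∈ EnvHopf.grading ℒ n := by
  have := prod_mem_grading (k := k) (ℒ := ℒ) [(n, x)] (by simpa using hx)
  simpa only [List.map_cons, List.map_nil, List.prod_cons, List.prod_nil, mul_one, List.sum_cons,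
    List.sum_nil, add_zero] using this

theorem grading_mul_le (i j : ℕ) :
    EnvHopf.grading ℒ i * EnvHopf.grading ℒ j ≤ (EnvHopf.grading ℒ (i + j) : Submodule k U) := by
  conv_lhs => unfold EnvHopf.grading
  rw [Submodule.span_mul_span, Submodule.span_le]
  rintro _ ⟨_, ⟨l, hl, rfl, rfl⟩, _, ⟨l', hl', rfl, rfl⟩, rfl⟩
  refine Submodule.subset_span ⟨l ++ l', ?_, by simp, by simp⟩
  intro p hp
  rcases List.mem_append.1 hp with hp | hp
  · exact hl p hp
  · exact hl' p hp

theorem comul_prod_mem (l : List (ℕ × L)) (hl : ∀ p ∈ l, p.2 ∈ ℒ p.1) :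
    Coalgebra.comul (R := k) (l.map fun p => (ι p.2 : U)).prod ∈
      tensFil (EnvHopf.grading ℒ) (l.map Prod.fst).sum := by
  induction l with
  | nil =>
    simp only [List.map_nil, List.prod_nil, List.sum_nil, Bialgebra.comul_one]
    exact tens_le_tensFil _ 0 0 (tmul_mem_tens one_mem_grading one_mem_grading)
  | cons p l ih =>
    simp only [List.map_cons, List.prod_cons, List.sum_cons, Bialgebra.comul_mul]
    have hp := ι_mem_grading (k := k) (hl p (by simp))
    refine tensFil_mul_le grading_mul_le _ _ (Submodule.mul_mem_mul ?_
      (ih fun q hq => hl q (by simp [hq])))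
    rw [env_comul_ι]
    exact add_mem (tens_le_tensFil _ p.1 0 (tmul_mem_tens hp one_mem_grading))
      (zero_add p.1 ▸ tens_le_tensFil _ 0 p.1 (tmul_mem_tens one_mem_grading hp))

theorem antipode_prod_mem (l : List (ℕ × L)) (hl : ∀ p ∈ l, p.2 ∈ ℒ p.1) :
    HopfAlgebra.antipode k (l.map fun p => (ι p.2 : U)).prod ∈
      EnvHopf.grading ℒ (l.map Prod.fst).sum := by
  induction l with
  | nil =>
    simp only [List.map_nil, List.prod_nil, List.sum_nil, HopfAlgebra.antipode_one]
    exact one_mem_grading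
  | cons p l ih =>
    simp only [List.map_cons, List.prod_cons, List.sum_cons, HopfAlgebra.antipode_mul_antidistrib]
    rw [env_antipode_ι, add_comm]
    exact grading_mul_le _ _ (Submodule.mul_mem_mul (ih fun q hq => hl q (by simp [hq]))
      (neg_mem (ι_mem_grading (hl p (by simp)))))

theorem counit_prod_eq_zero (l : List (ℕ × L)) (hl : (l.map Prod.fst).sum ≠ 0) :
    Coalgebra.counit (R := k) (l.map fun p => (ι p.2 : U)).prod = 0 := by
  cases l with
  | nil => simp at hl
  | cons p l =>
    simp only [List.map_cons, List.prod_cons, Bialgebra.counit_mul]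
    rw [env_counit_ι, zero_mul]

theorem iSup_grading_eq_top (hℒ : ⨆ n, ℒ n = ⊤) :
    ⨆ n, (EnvHopf.grading ℒ n : Submodule k U) = ⊤ := by
  set T := ⨆ n, (EnvHopf.grading ℒ n : Submodule k U) with hT
  have hmul : T * T ≤ T := by
    conv_lhs => rw [hT]
    simp only [Submodule.iSup_mul, Submodule.mul_iSup, iSup_le_iff]
    intro i j
    exact (grading_mul_le _ _).trans (le_iSup (fun n => (EnvHopf.grading ℒ n : Submodule k U)) _)
  have hone : (1 : U) ∈ T := Submodule.mem_iSup_of_mem 0 one_mem_grading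
  have hle : Algebra.adjoin k (Set.range (ι : L → U)) ≤
      T.toSubalgebra hone fun x y hx hy => hmul (Submodule.mul_mem_mul hx hy) := by
    refine Algebra.adjoin_le ?_
    rintro _ ⟨x, rfl⟩
    have hx : x ∈ ⨆ n, ℒ n := by rw [hℒ]; trivial
    suffices h : ⨆ n, ℒ n ≤ T.comap (ι : L →ₗ⁅k⁆ U).toLinearMap from h hx
    exact iSup_le fun n y hy => Submodule.mem_iSup_of_mem n (ι_mem_grading hy)
  rw [EnvHopf.adjoin_ι] at hle
  exact eq_top_iff.2 fun u _ => hle trivial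

end Source

/-! ### The canonical map is a morphism of graded Hopf algebras; conclusion. -/

section Main

variable {k H : Type*} [Field k] [Ring H] [HopfAlgebra k H] {𝒜 : ℕ → Submodule k H}

theorem iSup_primitiveGrading (h𝒜 : IsGradedHopfAlgebra 𝒜) :
    ⨆ n, primitiveGrading 𝒜 n = ⊤ := by
  rw [eq_top_iff]
  intro x _
  obtain ⟨N, hN⟩ := exists_eq_sum_gproj h𝒜.isInternal (x : H)
  have hx : x = ∑ i ∈ Finset.range N, (⟨gproj h𝒜.isInternal i x,
      gproj_mem_primitiveSpace h𝒜 i x.2⟩ : primitiveSpace k H) := by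
    apply Subtype.ext
    refine (hN N le_rfl).symm.trans ?_
    exact (map_sum (primitiveSpace k H).incl (fun i => (⟨gproj h𝒜.isInternal i x,
      gproj_mem_primitiveSpace h𝒜 i x.2⟩ : primitiveSpace k H)) (Finset.range N)).symm
  rw [hx]
  exact sum_mem fun i _ => Submodule.mem_iSup_of_mem i (gproj_mem h𝒜.isInternal i (x : H))

theorem map_mem_of_mem_grading (h𝒜 : IsGradedHopfAlgebra 𝒜) (n : ℕ) :
    EnvHopf.grading (primitiveGrading 𝒜) n ≤
      (𝒜 n).comap (envPrimitiveMap k H).toLinearMap := by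
  refine grading_le (W := fun n => (𝒜 n).comap (envPrimitiveMap k H).toLinearMap) ?_ n
  intro l hl
  change envPrimitiveMap k H _ ∈ 𝒜 _
  induction l with
  | nil =>
    simp only [List.map_nil, List.prod_nil, List.sum_nil, map_one]
    exact h𝒜.one_mem
  | cons p l ih =>
    simp only [List.map_cons, List.prod_cons, List.sum_cons, map_mul]
    refine h𝒜.mul_mem ?_ (ih fun q hq => hl q (by simp [hq]))
    rw [envPrimitiveMap_ι]
    exact hl p (by simp)

/-- The pieces of the grading map into the pieces of `H`, so their independence is pulled back along
the injective canonical map; no basis of the enveloping algebra is needed. -/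
theorem isGradedHopfAlgebra_env (h𝒜 : IsGradedHopfAlgebra 𝒜)
    (hinj : Function.Injective (envPrimitiveMap k H)) :
    IsGradedHopfAlgebra (EnvHopf.grading (primitiveGrading 𝒜)) where
  isInternal := by
    refine DirectSum.isInternal_submodule_of_iSupIndep_of_iSup_eq_top ?_
      (iSup_grading_eq_top (iSup_primitiveGrading h𝒜))
    intro i
    rw [Submodule.disjoint_def]
    intro u hu hu'
    have hdis := Submodule.disjoint_def.1 (h𝒜.isInternal.submodule_iSupIndep i)
    refine hinj ?_
    rw [map_zero]
    refine hdis _ (map_mem_of_mem_grading h𝒜 i hu) ?_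
    have hle : ⨆ j, ⨆ (_ : j ≠ i), EnvHopf.grading (primitiveGrading 𝒜) j ≤
        (⨆ j, ⨆ (_ : j ≠ i), 𝒜 j).comap (envPrimitiveMap k H).toLinearMap :=
      iSup₂_le fun j hj u hu =>
        (le_iSup₂_of_le j hj le_rfl : 𝒜 j ≤ ⨆ j, ⨆ (_ : j ≠ i), 𝒜 j)
          (map_mem_of_mem_grading h𝒜 j hu)
    exact hle hu'
  one_mem := one_mem_grading
  mul_mem _ _ _ _ ha hb := grading_mul_le _ _ (Submodule.mul_mem_mul ha hb)
  comul_mem n a ha := by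
    simp only [range_map_subtype]
    exact grading_le (W := fun n => (tensFil (EnvHopf.grading (primitiveGrading 𝒜)) n).comap
      Coalgebra.comul) comul_prod_mem n ha
  counit_eq_zero n a hn ha := by
    have hle : EnvHopf.grading (primitiveGrading 𝒜) n ≤ LinearMap.ker
        (Coalgebra.counit (R := k) (A := UniversalEnvelopingAlgebra k (primitiveSpace k H))) := by
      refine Submodule.span_le.2 ?_
      rintro _ ⟨l, -, rfl, rfl⟩
      exact counit_prod_eq_zero l hn
    exact hle ha
  antipode_mem n a ha :=
    grading_le (W := fun n => (EnvHopf.grading (primitiveGrading 𝒜) n).comap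
      (HopfAlgebra.antipode k)) antipode_prod_mem n ha

theorem comul_envPrimitiveMap (u : UniversalEnvelopingAlgebra k (primitiveSpace k H)) :
    Coalgebra.comul (R := k) (envPrimitiveMap k H u) =
      TensorProduct.map (envPrimitiveMap k H).toLinearMap (envPrimitiveMap k H).toLinearMap
        (Coalgebra.comul (R := k) u) := by
  have h : (Bialgebra.comulAlgHom k H).comp (envPrimitiveMap k H) =
      (Algebra.TensorProduct.map (envPrimitiveMap k H) (envPrimitiveMap k H)).comp
        (Bialgebra.comulAlgHom k _) := by
    apply EnvHopf.hom_ext'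
    intro x
    change Coalgebra.comul (R := k) (envPrimitiveMap k H _) =
      Algebra.TensorProduct.map (envPrimitiveMap k H) (envPrimitiveMap k H)
        (Coalgebra.comul (R := k) _)
    rw [env_comul_ι, map_add, Algebra.TensorProduct.map_tmul, Algebra.TensorProduct.map_tmul,
      map_one, envPrimitiveMap_ι]
    exact x.2
  exact congrArg (fun f => f u) h

theorem counit_envPrimitiveMap (u : UniversalEnvelopingAlgebra k (primitiveSpace k H)) :
    Coalgebra.counit (R := k) (envPrimitiveMap k H u) = Coalgebra.counit (R := k) u := by
  have h : (Bialgebra.counitAlgHom k H).comp (envPrimitiveMap k H) =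
      Bialgebra.counitAlgHom k _ := by
    apply EnvHopf.hom_ext'
    intro x
    change Coalgebra.counit (R := k) (envPrimitiveMap k H _) =
      Coalgebra.counit (R := k) (UniversalEnvelopingAlgebra.ι k x)
    rw [env_counit_ι, envPrimitiveMap_ι]
    exact counit_eq_zero_of_mem_primitiveSpace x.2
  exact congrArg (fun f => f u) h

theorem antipode_of_mem_primitiveSpace {x : H} (hx : x ∈ primitiveSpace k H) :
    HopfAlgebra.antipode k x = -x := by
  have h1 : Coalgebra.comul (R := k) x = x ⊗ₜ[k] 1 + 1 ⊗ₜ[k] x := hx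
  have h2 := HopfAlgebra.mul_antipode_rTensor_comul_apply (R := k) x
  rw [h1, counit_eq_zero_of_mem_primitiveSpace hx, map_zero] at h2
  simp only [map_add, LinearMap.rTensor_tmul, LinearMap.mul'_apply, mul_one,
    HopfAlgebra.antipode_one, one_mul] at h2
  exact eq_neg_of_add_eq_zero_left h2

theorem antipode_envPrimitiveMap (u : UniversalEnvelopingAlgebra k (primitiveSpace k H)) :
    HopfAlgebra.antipode k (envPrimitiveMap k H u) =
      envPrimitiveMap k H (HopfAlgebra.antipode k u) := by
  have hu : u ∈ Algebra.adjoin k (Set.range (UniversalEnvelopingAlgebra.ι k :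
      primitiveSpace k H → UniversalEnvelopingAlgebra k (primitiveSpace k H))) := by
    rw [EnvHopf.adjoin_ι]
    trivial
  induction hu using Algebra.adjoin_induction with
  | mem u hu =>
    obtain ⟨x, rfl⟩ := hu
    rw [env_antipode_ι, map_neg, envPrimitiveMap_ι, antipode_of_mem_primitiveSpace x.2]
  | algebraMap r =>
    rw [AlgHom.commutes, Algebra.algebraMap_eq_smul_one, Algebra.algebraMap_eq_smul_one, map_smul,
      map_smul, HopfAlgebra.antipode_one, HopfAlgebra.antipode_one, map_smul, map_one]
  | add a b _ _ ha hb => simp only [map_add, ha, hb]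
  | mul a b _ _ ha hb =>
    rw [map_mul, HopfAlgebra.antipode_mul_antidistrib, HopfAlgebra.antipode_mul_antidistrib,
      map_mul, ha, hb]

end Main

theorem mainTheorem8 {k H : Type*} [Field k] [CharZero k] [Ring H] [HopfAlgebra k H]
    (𝒜 : ℕ → Submodule k H) (h𝒜 : IsConnectedGradedHopfAlgebra 𝒜)
    (d : ℝ) (hd : gkDim k H = (d : EReal)) :
    Module.Finite k (primitiveSpace k H) ∧
      ∃ n : ℕ, (n : ℝ) = d - Module.finrank k (primitiveSpace k H) ∧
        IsGradedIHOEOfDerivationType (EnvHopf.grading (primitiveGrading 𝒜)) 𝒜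
          (envPrimitiveMap k H) n := by
  have hG := h𝒜.toIsGradedHopfAlgebra
  obtain ⟨hfin, hinj, hU⟩ := exists_normalExt_range h𝒜 hd
  obtain ⟨n, hn⟩ := exists_normalExt_top h𝒜 hd (hU.tower Tower.base)
  refine ⟨hfin, n, ?_, isGradedHopfAlgebra_env hG hinj, hG, hinj, comul_envPrimitiveMap,
    counit_envPrimitiveMap, antipode_envPrimitiveMap,
    fun i r hr => map_mem_of_mem_grading hG i hr,
    hn.exists_chain hG (hU.isGradedSub hG (isGradedSub_bot hG))⟩
  -- The chain from `k` through the image of `U(P(H))` to `H` has `dim P(H) + n` steps, and this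
  -- number equals `d`.
  have := (hU.trans hn).eq_gkDim h𝒜 hd
  push_cast at this
  linarith
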